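/- For every integer $N\ge 1$ there is a constant $c_N\in(0,\infty)$, depending only on $N$, with the following property. Let $P$ be an $N\times N$ (complex) Hermitian matrix, and let $Q$ be an $N\times N$ GUE matrix, i.e. a random Hermitian matrix whose law has the density $q\mapsto \frac1{Z_N}\exp\bigl(-\frac N2\sum_{i,j}|q_{ij}|^2\bigr)$ with respect to Lebesgue measure on the space of $N\times N$ Hermitian matrices. Put $\tilde P=P+e^{-N}Q$ and $$\psi(N,P)=\exp\Bigl(e^{2N}\sum_{k,l}|P_{kl}|^2\Bigr),$$ let $\alpha_1\le\dots\le\alpha_N$ be the eigenvalues of $\tilde P$, and let $\gamma_1\le\dots\le\gamma_N$ be the eigenvalues of $P$ (both with multiplicity). Then $\alpha_1,\dots,\alpha_N$ are almost surely distinct, $$\mathbb E\sum_{i\ne j}|\alpha_i-\alpha_j|^{-1}<c_N\,\psi(N,P),\qquad \mathbb P\Bigl[\min_{i\ne j}|\alpha_i-\alpha_j|\le\delta\Bigr]\le c_N\,\psi(N,P)\,\delta^2\quad\text{for all }\delta\in(0,1),$$ and $$\mathbb P\Bigl[\max_{1\le k\le N}|\alpha_k-\gamma_k|\ge e^{-N/2}\Bigr]\le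 e^{-e^{N/2}}.$$ The same holds, with the same $c_N$, if $P$ is a random Hermitian matrix independent of $Q$, where in the two bounds involving $\psi(N,P)$ the expectation and the probability are replaced by the conditional expectation and the conditional probability given $P$, and these bounds (the second one for each $\delta\in(0,1)$) hold almost surely. (For $N=1$ the sum over $i\neq j$ is $0$ and the minimum over $i\ne j$ is $+\infty$.) -/

import Mathlib

open MeasureTheory ProbabilityTheory
open scoped ENNReal

noncomputable section

/-- The entrywise product sigma-algebra on matrices (which is the Borel sigma-algebra for complex
matrices). -/
instance matrixMeasurableSpace {m n α : Type*} [MeasurableSpace α] :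
    MeasurableSpace (Matrix m n α) :=
  inferInstanceAs (MeasurableSpace (m → n → α))

/-- The real vector space of `N × N` Hermitian matrices, with the sigma-algebra induced from
complex matrices. -/
abbrev HermMat (N : ℕ) : Type := selfAdjoint (Matrix (Fin N) (Fin N) ℂ)

namespace HermMat

variable {N : ℕ}

theorem isHermitian (M : HermMat N) : (M : Matrix (Fin N) (Fin N) ℂ).IsHermitian := M.2

/-- The eigenvalues of a Hermitian matrix, with multiplicity, in nondecreasing order
(Mathlib's `eigenvalues₀` lists them in nonincreasing order). -/
def eig (M : HermMat N) (k : Fin N) : ℝ :=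
  M.isHermitian.eigenvalues₀ (Fin.cast (Fintype.card_fin N).symm k.rev)

theorem eig_monotone (M : HermMat N) : Monotone M.eig := fun i j hij =>
  M.isHermitian.eigenvalues₀_antitone (by
    simpa [Fin.le_def] using Fin.rev_le_rev.mpr hij)

/-- The squared Frobenius norm `∑ₖₗ |Mₖₗ|²`. -/
def frobSq (M : HermMat N) : ℝ :=
  ∑ k, ∑ l, ‖(M : Matrix (Fin N) (Fin N) ℂ) k l‖ ^ 2

/-- The sum over ordered pairs `i ≠ j` of `|αᵢ - αⱼ|⁻¹`, where `α₁ ≤ … ≤ α_N` are the eigenvalues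
of `M`. It has values in `[0, ∞]`, and equals `∞` if two eigenvalues coincide. -/
def invGapSum (M : HermMat N) : ℝ≥0∞ :=
  ∑ p ∈ (Finset.univ : Finset (Fin N)).offDiag, (ENNReal.ofReal |M.eig p.1 - M.eig p.2|)⁻¹

/-- The event that `min_{i ≠ j} |αᵢ - αⱼ| ≤ δ` (for `N = 1` there are no pairs, and the minimum
over the empty set is `∞`). -/
def MinGapLE (M : HermMat N) (δ : ℝ) : Prop :=
  ∃ i j : Fin N, i ≠ j ∧ |M.eig i - M.eig j| ≤ δ

/-- The matrix whose upper triangular part is `(wᵢⱼ + 𝐢 wⱼᵢ 1_{i ≠ j})_{i ≤ j}`. -/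
def matrixOfCoords (w : Fin N → Fin N → ℝ) : Matrix (Fin N) (Fin N) ℂ :=
  Matrix.of fun i j =>
    if i < j then (w i j : ℂ) + (w j i : ℂ) * Complex.I
    else if i = j then (w i i : ℂ)
    else (w j i : ℂ) - (w i j : ℂ) * Complex.I

theorem isSelfAdjoint_matrixOfCoords (w : Fin N → Fin N → ℝ) :
    IsSelfAdjoint (matrixOfCoords w) := by
  ext i j
  rcases lt_trichotomy i j with h | h | h
  · simp [matrixOfCoords, Matrix.star_apply, h, h.not_gt, h.ne']
  · subst h
    simp [matrixOfCoords, Matrix.star_apply]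
  · simp [matrixOfCoords, Matrix.star_apply, h, h.not_gt, h.ne', sub_eq_add_neg]

/-- The parametrization of Hermitian matrices by `ℝ^(N × N)`. -/
def ofCoords (w : Fin N → Fin N → ℝ) : HermMat N :=
  ⟨matrixOfCoords w, isSelfAdjoint_matrixOfCoords w⟩

/-- Lebesgue measure on the space of `N × N` Hermitian matrices, inherited from `ℝ^(N × N)`. -/
def lebesgue (N : ℕ) : Measure (HermMat N) :=
  (volume : Measure (Fin N → Fin N → ℝ)).map ofCoords

/-- The unnormalized GUE density `q ↦ exp(-(N/2) ∑ᵢⱼ |qᵢⱼ|²)`. -/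
def gueWeight (q : HermMat N) : ℝ≥0∞ :=
  ENNReal.ofReal (Real.exp (-((N : ℝ) / 2) * q.frobSq))

/-- The law of the `N × N` GUE: the probability measure on Hermitian matrices with density
`Z⁻¹ exp(-(N/2) ∑ᵢⱼ |qᵢⱼ|²)` with respect to Lebesgue measure. -/
def gue (N : ℕ) : Measure (HermMat N) :=
  (∫⁻ q, gueWeight q ∂(lebesgue N))⁻¹ • (lebesgue N).withDensity gueWeight

/-- `ψ(N, P) = exp(e^{2N} ∑ₖₗ |Pₖₗ|²)`. -/
def psi (P : HermMat N) : ℝ := Real.exp (Real.exp (2 * (N : ℝ)) * P.frobSq)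

/-- The perturbed matrix `P + e^{-N} Q`. -/
def perturb (P Q : HermMat N) : HermMat N := P + Real.exp (-(N : ℝ)) • Q

/-- The event that `max_k |αₖ - γₖ| ≥ e^{-N/2}`, where `α₁ ≤ … ≤ α_N` and `γ₁ ≤ … ≤ γ_N` are the
eigenvalues of `A` and of `P`. -/
def FarEigenvalues (A P : HermMat N) : Prop :=
  ∃ k : Fin N, Real.exp (-((N : ℝ) / 2)) ≤ |A.eig k - P.eig k|

end HermMat

end

/-! The core is a volume estimate: among Hermitian matrices with real coordinates bounded by `n`,
those having two eigenvalues within `δ` occupy volume `O(n ^ m * δ ^ 2)`. No joint eigenvalue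
density is used. Two nearby eigenvalues span a plane of approximate eigenvectors, so one of these
can be chosen with a prescribed zero entry at `q` and with its largest entry, at some `p`,
normalized to `1` (`exists_approx_eigenvector`). Such pairs (approximate eigenvalue, approximate
eigenvector) form a real parameter space of dimension `1 + 2(N - 2) = 2N - 3`.

For a fixed pair, the approximate eigenvector equation determines the `2N - 1` real coordinates in
row and column `p` up to `O(δ)`, so the matrices solving it have volume `O(δ ^ (2N - 1))`
(`volume_approx_eigenvector_le`). Conversely, a matrix with a small gap admits a whole `δ`-ball of
pairs if the tolerance is increased by a constant factor. Computing the volume of the incidence set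
in both orders and dividing by `δ ^ (2N - 3)` leaves `δ ^ 2` (`volume_minGapLE_pivot_le`).

Completing a square bounds the density of `P + e^{-N} Q` by `ψ(N, P)` times a centred Gaussian
independent of `P` up to constants (`lintegral_perturb_gue_le`); the polynomial growth in `n` is
absorbed by the Gaussian. This gives the gap probability. Summing it over dyadic scales bounds the
expected inverse gaps, and finiteness of that expectation forces distinct eigenvalues almost surely.

The displacement bound is separate: Weyl's inequality reduces it to the event `e^N ≤ ‖Q‖²` in
Frobenius norm, which is controlled by an exponential moment for `N ≥ 2` and by a scalar Gaussian
tail for `N = 1`. Random `P` follows from the deterministic bounds by integrating out the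
independent `Q`. -/

noncomputable section

/-! ### Eigenbases and Weyl's inequality. -/

namespace HermMat

variable {N : ℕ}

/-- An orthonormal basis of eigenvectors, ordered as the eigenvalues `eig`. -/
theorem exists_eigenbasis (M : HermMat N) :
    ∃ b : OrthonormalBasis (Fin N) ℂ (EuclideanSpace ℂ (Fin N)),
      ∀ k, (M : Matrix (Fin N) (Fin N) ℂ).toEuclideanLin (b k) = ((M.eig k : ℝ) : ℂ) • b k := by
  let e : Fin N ≃ Fin (Fintype.card (Fin N)) :=
    Fin.revPerm.trans (finCongr (Fintype.card_fin N).symm)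
  let b := ((Matrix.isSymmetric_toEuclideanLin_iff.mpr M.isHermitian).eigenvectorBasis
    finrank_euclideanSpace).reindex e.symm
  refine ⟨b, fun k => ?_⟩
  have := (Matrix.isSymmetric_toEuclideanLin_iff.mpr M.isHermitian).apply_eigenvectorBasis
    finrank_euclideanSpace (e k)
  simp [b, e, eig, Matrix.IsHermitian.eigenvalues₀]

theorem norm_toEuclideanLin_sq_le (M : HermMat N) (x : EuclideanSpace ℂ (Fin N)) :
    ‖(M : Matrix (Fin N) (Fin N) ℂ).toEuclideanLin x‖ ^ 2 ≤ M.frobSq * ‖x‖ ^ 2 := by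
  rw [EuclideanSpace.norm_sq_eq, EuclideanSpace.norm_sq_eq, frobSq, Finset.sum_mul]
  refine Finset.sum_le_sum fun i _ => ?_
  have h1 : ‖(M : Matrix (Fin N) (Fin N) ℂ).toEuclideanLin x i‖ ≤
      ∑ j, ‖(M : Matrix (Fin N) (Fin N) ℂ) i j‖ * ‖x j‖ := by
    simp only [Matrix.toLpLin_apply, Matrix.mulVec, dotProduct]
    refine (norm_sum_le _ _).trans (le_of_eq ?_)
    simp
  calc _ ≤ (∑ j, ‖(M : Matrix (Fin N) (Fin N) ℂ) i j‖ * ‖x j‖) ^ 2 := by gcongr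
    _ ≤ _ := Finset.sum_mul_sq_le_sq_mul_sq _ _ _

theorem frobSq_nonneg (M : HermMat N) : 0 ≤ M.frobSq := by
  unfold frobSq; positivity

theorem norm_toEuclideanLin_le (M : HermMat N) (x : EuclideanSpace ℂ (Fin N)) :
    ‖(M : Matrix (Fin N) (Fin N) ℂ).toEuclideanLin x‖ ≤ √M.frobSq * ‖x‖ := by
  refine le_of_sq_le_sq ?_ (by positivity)
  rw [mul_pow, Real.sq_sqrt M.frobSq_nonneg]
  exact M.norm_toEuclideanLin_sq_le x

theorem re_inner_toEuclideanLin_eq_sum (M : HermMat N)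
    (b : OrthonormalBasis (Fin N) ℂ (EuclideanSpace ℂ (Fin N)))
    (hb : ∀ k, (M : Matrix (Fin N) (Fin N) ℂ).toEuclideanLin (b k) = ((M.eig k : ℝ) : ℂ) • b k)
    (x : EuclideanSpace ℂ (Fin N)) :
    (inner ℂ x ((M : Matrix (Fin N) (Fin N) ℂ).toEuclideanLin x)).re =
      ∑ k, M.eig k * ‖inner ℂ (b k) x‖ ^ 2 := by
  rw [← b.sum_inner_mul_inner, Complex.re_sum]
  refine Finset.sum_congr rfl fun k _ => ?_
  rw [← (Matrix.isSymmetric_toEuclideanLin_iff.mpr M.isHermitian) (b k) x, hb, inner_smul_left,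
    Complex.conj_ofReal, mul_left_comm, ← inner_conj_symm x (b k), ← Complex.normSq_eq_conj_mul_self,
    Complex.normSq_eq_norm_sq]
  norm_cast

/-- Weyl's inequality, with the Frobenius norm. -/
theorem eig_le_eig_add (A B : HermMat N) (k : Fin N) :
    A.eig k ≤ B.eig k + √(A - B).frobSq := by
  obtain ⟨a, ha⟩ := A.exists_eigenbasis
  obtain ⟨b, hb⟩ := B.exists_eigenbasis
  obtain ⟨x, hx0, hxa, hxb⟩ : ∃ x : EuclideanSpace ℂ (Fin N), x ≠ 0 ∧
      (∀ i < k, inner ℂ (a i) x = 0) ∧ (∀ i, k < i → inner ℂ (b i) x = 0) := by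
    -- The index `k` imposes no condition, so there are only `N - 1` linear equations on an
    -- `N`-dimensional space and a nonzero solution exists.
    let f : EuclideanSpace ℂ (Fin N) →ₗ[ℂ] ({i : Fin N // i ≠ k} → ℂ) :=
      LinearMap.pi fun i => if i.1 < k then (innerSL ℂ (a i)).toLinearMap
        else (innerSL ℂ (b i)).toLinearMap
    have hlt : Module.finrank ℂ ({i : Fin N // i ≠ k} → ℂ) <
        Module.finrank ℂ (EuclideanSpace ℂ (Fin N)) := by
      have := k.2
      rw [Module.finrank_fintype_fun_eq_card, finrank_euclideanSpace, Fintype.card_subtype_compl]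
      simp
      omega
    obtain ⟨x, hx, hx0⟩ := (Submodule.ne_bot_iff _).1 (LinearMap.ker_ne_bot_of_finrank_lt hlt (f := f))
    refine ⟨x, hx0, fun i hi => ?_, fun i hi => ?_⟩
    · have := congrFun (LinearMap.mem_ker.1 hx) ⟨i, hi.ne⟩
      simpa [f, hi] using this
    · have := congrFun (LinearMap.mem_ker.1 hx) ⟨i, hi.ne'⟩
      simpa [f, hi.not_gt] using this
  have h1 : A.eig k * ‖x‖ ^ 2 ≤
      (inner ℂ x ((A : Matrix (Fin N) (Fin N) ℂ).toEuclideanLin x)).re := by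
    rw [A.re_inner_toEuclideanLin_eq_sum a ha, ← a.sum_sq_norm_inner_right, Finset.mul_sum]
    refine Finset.sum_le_sum fun i _ => ?_
    rcases lt_or_ge i k with h | h
    · simp [hxa i h]
    · gcongr
      exact A.eig_monotone h
  have h2 : (inner ℂ x ((B : Matrix (Fin N) (Fin N) ℂ).toEuclideanLin x)).re ≤
      B.eig k * ‖x‖ ^ 2 := by
    rw [B.re_inner_toEuclideanLin_eq_sum b hb, ← b.sum_sq_norm_inner_right, Finset.mul_sum]
    refine Finset.sum_le_sum fun i _ => ?_
    rcases lt_or_ge k i with h | h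
    · simp [hxb i h]
    · gcongr
      exact B.eig_monotone h
  have h3 : (inner ℂ x (((A - B : HermMat N) : Matrix (Fin N) (Fin N) ℂ).toEuclideanLin x)).re ≤
      √(A - B).frobSq * ‖x‖ ^ 2 := by
    refine (Complex.re_le_norm _).trans ((norm_inner_le_norm _ _).trans ?_)
    have := (A - B).norm_toEuclideanLin_le x
    nlinarith [norm_nonneg x]
  have h4 : (inner ℂ x (((A - B : HermMat N) : Matrix (Fin N) (Fin N) ℂ).toEuclideanLin x)) =
      inner ℂ x ((A : Matrix (Fin N) (Fin N) ℂ).toEuclideanLin x) -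
      inner ℂ x ((B : Matrix (Fin N) (Fin N) ℂ).toEuclideanLin x) := by
    rw [AddSubgroupClass.coe_sub, map_sub, LinearMap.sub_apply, inner_sub_right]
  rw [h4, Complex.sub_re] at h3
  have hx : 0 < ‖x‖ ^ 2 := by positivity
  by_contra! h
  nlinarith

theorem frobSq_neg (A : HermMat N) : (-A).frobSq = A.frobSq := by simp [frobSq]

theorem abs_eig_sub_eig_le (A B : HermMat N) (k : Fin N) :
    |A.eig k - B.eig k| ≤ √(A - B).frobSq := by
  have h1 := eig_le_eig_add A B k
  have h2 := eig_le_eig_add B A k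
  rw [← neg_sub A B, frobSq_neg] at h2
  rw [abs_le]
  constructor <;> linarith

/-! ### Real coordinates and measurability. -/

/-- The real coordinates of a Hermitian matrix. -/
def coords (M : HermMat N) (i j : Fin N) : ℝ :=
  if i ≤ j then ((M : Matrix (Fin N) (Fin N) ℂ) i j).re
  else ((M : Matrix (Fin N) (Fin N) ℂ) j i).im

theorem ofCoords_coords (M : HermMat N) : ofCoords M.coords = M := by
  apply Subtype.ext
  ext i j
  have h := fun i j => congrFun (congrFun M.isHermitian i) j
  simp only [Matrix.conjTranspose_apply] at h
  rcases lt_trichotomy i j with hij | hij | hij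
  · simp [ofCoords, matrixOfCoords, coords, hij, hij.le, hij.not_ge]
  · subst hij
    have h1 := congrArg Complex.im (h i i)
    simp only [RCLike.star_def, Complex.conj_im] at h1
    have h2 : ((M : Matrix (Fin N) (Fin N) ℂ) i i).im = 0 := by linarith
    simp [ofCoords, matrixOfCoords, coords, Complex.ext_iff, h2]
  · have h1 := h i j
    rw [← h1]
    simp [ofCoords, matrixOfCoords, coords, hij.le, hij.not_ge, hij.not_gt, hij.ne', Complex.ext_iff]

theorem measurable_coe_apply (i j : Fin N) :
    Measurable fun M : HermMat N => (M : Matrix (Fin N) (Fin N) ℂ) i j := by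
  have h1 : Measurable fun A : Matrix (Fin N) (Fin N) ℂ => A i j :=
    (measurable_pi_apply j).comp (measurable_pi_apply (X := fun _ : Fin N => Fin N → ℂ) i)
  exact h1.comp measurable_subtype_coe

theorem measurable_coords : Measurable (coords : HermMat N → Fin N → Fin N → ℝ) := by
  refine measurable_pi_lambda _ fun i => measurable_pi_lambda _ fun j => ?_
  by_cases h : i ≤ j
  · simpa [coords, h, Function.comp_def] using Complex.measurable_re.comp (measurable_coe_apply i j)
  · simpa [coords, h, Function.comp_def] using Complex.measurable_im.comp (measurable_coe_apply j i)

theorem measurable_of_entries {α : Type*} [MeasurableSpace α] {f : α → HermMat N}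
    (h : ∀ i j, Measurable fun a => (f a : Matrix (Fin N) (Fin N) ℂ) i j) : Measurable f := by
  refine Measurable.subtype_mk (measurable_pi_lambda _ fun i => measurable_pi_lambda _ fun j => h i j)

theorem measurable_ofCoords : Measurable (ofCoords : (Fin N → Fin N → ℝ) → HermMat N) := by
  refine measurable_of_entries fun i j => ?_
  simp only [ofCoords, matrixOfCoords, Matrix.of_apply]
  split_ifs <;> fun_prop

theorem ofCoords_sub (v w : Fin N → Fin N → ℝ) : ofCoords (v - w) = ofCoords v - ofCoords w := by
  apply Subtype.ext
  ext i j
  simp only [ofCoords, matrixOfCoords, Matrix.of_apply, AddSubgroupClass.coe_sub, Matrix.sub_apply]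
  split_ifs <;> push_cast [Pi.sub_apply] <;> ring

theorem ofCoords_zero : ofCoords (0 : Fin N → Fin N → ℝ) = 0 := by
  rw [← sub_self (0 : Fin N → Fin N → ℝ), ofCoords_sub, sub_self]

theorem ofCoords_add (v w : Fin N → Fin N → ℝ) : ofCoords (v + w) = ofCoords v + ofCoords w := by
  apply Subtype.ext
  ext i j
  simp only [ofCoords, matrixOfCoords, Matrix.of_apply, AddMemClass.coe_add, Matrix.add_apply]
  split_ifs <;> push_cast [Pi.add_apply] <;> ring

theorem ofCoords_smul (r : ℝ) (w : Fin N → Fin N → ℝ) : ofCoords (r • w) = r • ofCoords w := by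
  apply Subtype.ext
  ext i j
  simp only [ofCoords, matrixOfCoords, Matrix.of_apply, selfAdjoint.val_smul, Matrix.smul_apply]
  split_ifs <;> simp <;> ring

theorem continuous_frobSq_ofCoords :
    Continuous fun w : Fin N → Fin N → ℝ => (ofCoords w).frobSq := by
  simp only [frobSq, ofCoords, matrixOfCoords, Matrix.of_apply]
  refine continuous_finsetSum _ fun i _ => continuous_finsetSum _ fun j _ => ?_
  split_ifs <;> fun_prop

/-- Weyl's inequality bounds the change of an ordered eigenvalue by the Frobenius norm of the change
of the matrix, which is continuous in the coordinates. Measurability of `eig` on `HermMat N` is then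
pulled back through `coords`. -/
theorem continuous_eig_ofCoords (k : Fin N) :
    Continuous fun w : Fin N → Fin N → ℝ => (ofCoords w).eig k := by
  rw [continuous_iff_continuousAt]
  intro w
  rw [ContinuousAt, tendsto_iff_dist_tendsto_zero]
  have h : Filter.Tendsto (fun v : Fin N → Fin N → ℝ => √(ofCoords (v - w)).frobSq)
      (nhds w) (nhds 0) := by
    have hc : Continuous fun v : Fin N → Fin N → ℝ => √(ofCoords (v - w)).frobSq :=
      (continuous_frobSq_ofCoords.comp (continuous_id.sub continuous_const)).sqrt
    have := hc.tendsto w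
    simpa only [sub_self, ofCoords_zero, frobSq, ZeroMemClass.coe_zero, Matrix.zero_apply, norm_zero,
      ne_eq, OfNat.ofNat_ne_zero, not_false_eq_true, zero_pow, Finset.sum_const_zero,
      Real.sqrt_zero] using this
  refine squeeze_zero (fun _ => dist_nonneg) (fun v => ?_) h
  rw [Real.dist_eq, ofCoords_sub]
  exact abs_eig_sub_eig_le _ _ k

theorem measurable_eig (k : Fin N) : Measurable fun M : HermMat N => M.eig k := by
  have := (continuous_eig_ofCoords (N := N) k).measurable.comp measurable_coords
  simpa [Function.comp_def, ofCoords_coords] using this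

theorem measurable_frobSq : Measurable (frobSq : HermMat N → ℝ) := by
  have := (continuous_frobSq_ofCoords (N := N)).measurable.comp measurable_coords
  simpa [Function.comp_def, ofCoords_coords] using this

theorem measurable_invGapSum : Measurable (invGapSum : HermMat N → ℝ≥0∞) := by
  refine Finset.measurable_fun_sum _ fun p _ => ?_
  exact ((measurable_eig p.1).sub (measurable_eig p.2)).abs.ennreal_ofReal.inv

theorem measurableSet_minGapLE (δ : ℝ) : MeasurableSet {M : HermMat N | M.MinGapLE δ} := by
  simp only [MinGapLE, Set.ofPred_exists]
  refine MeasurableSet.iUnion fun i => MeasurableSet.iUnion fun j => ?_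
  refine MeasurableSet.inter (MeasurableSet.const _) ?_
  exact measurableSet_le ((measurable_eig i).sub (measurable_eig j)).abs measurable_const

theorem measurable_perturb : Measurable fun x : HermMat N × HermMat N => x.1.perturb x.2 := by
  refine measurable_of_entries fun i j => ?_
  simp only [perturb, AddMemClass.coe_add, Matrix.add_apply, selfAdjoint.val_smul,
    Matrix.smul_apply]
  exact ((measurable_coe_apply i j).comp measurable_fst).add
    (((measurable_coe_apply i j).comp measurable_snd).fun_const_smul _)

end HermMat
end

/-! ### Volumes of sets in which some coordinates nearly determine the others. -/

noncomputable section

theorem volume_pi_real_closedBall {κ : Type*} [Fintype κ] (x : κ → ℝ) {r : ℝ} (hr : 0 ≤ r) :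
    volume (Metric.closedBall x r) = ENNReal.ofReal (2 * r) ^ Fintype.card κ := by
  simp [volume_pi_closedBall _ hr, Real.volume_closedBall]

/-- A bound for the volume of a bounded set in which the coordinates satisfying `q` are determined
up to `ε` by the others. -/
theorem volume_le_of_determined {κ : Type*} [Fintype κ] (q : κ → Prop) [DecidablePred q]
    {S : Set (κ → ℝ)} (hS : MeasurableSet S) {n ε : ℝ} (hn₀ : 0 ≤ n) (hε₀ : 0 ≤ ε)
    (hn : ∀ w ∈ S, ∀ i, |w i| ≤ n)
    (hε : ∀ w ∈ S, ∀ w' ∈ S, (∀ i, ¬ q i → w i = w' i) → ∀ i, q i → |w i - w' i| ≤ ε) :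
    volume S ≤ ENNReal.ofReal (2 * n) ^ Fintype.card {i // ¬ q i} *
      ENNReal.ofReal (2 * ε) ^ Fintype.card {i // q i} := by
  let e := MeasurableEquiv.piEquivPiSubtypeProd (fun _ : κ => ℝ) q
  have he : MeasurePreserving e := volume_preserving_piEquivPiSubtypeProd (fun _ : κ => ℝ) q
  have hT : MeasurableSet (e.symm ⁻¹' S) := e.symm.measurable hS
  have h1 : volume S = volume (e.symm ⁻¹' S) :=
    ((he.symm e).measure_preimage hS.nullMeasurableSet).symm
  have he1 : ∀ x y (i : {i // q i}), e.symm (x, y) i = x i := fun x y i => by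
    simp [e, MeasurableEquiv.piEquivPiSubtypeProd, Equiv.piEquivPiSubtypeProd, i.2]
  have he2 : ∀ x y (i : {i // ¬ q i}), e.symm (x, y) i = y i := fun x y i => by
    simp [e, MeasurableEquiv.piEquivPiSubtypeProd, Equiv.piEquivPiSubtypeProd, i.2]
  rw [h1, Measure.volume_eq_prod, Measure.prod_apply_symm hT]
  have h2 : ∀ y : {i // ¬ q i} → ℝ, volume ((fun x => (x, y)) ⁻¹' (e.symm ⁻¹' S)) ≤
      (Metric.closedBall (0 : {i // ¬ q i} → ℝ) n).indicator
        (fun _ => ENNReal.ofReal (2 * ε) ^ Fintype.card {i // q i}) y := by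
    intro y
    rcases Set.eq_empty_or_nonempty ((fun x => (x, y)) ⁻¹' (e.symm ⁻¹' S)) with h | ⟨x₀, hx₀⟩
    · rw [h]; simp
    have hx₀' : e.symm (x₀, y) ∈ S := hx₀
    have hy : y ∈ Metric.closedBall (0 : {i // ¬ q i} → ℝ) n := by
      rw [mem_closedBall_zero_iff, pi_norm_le_iff_of_nonneg hn₀]
      intro i
      have := hn _ hx₀' i.1
      rwa [he2] at this
    rw [Set.indicator_of_mem hy, ← volume_pi_real_closedBall x₀ hε₀]
    -- A nonempty slice lies in the sup-norm ball of radius `ε` about any one of its points.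
    refine measure_mono fun x (hx : e.symm (x, y) ∈ S) => ?_
    rw [Metric.mem_closedBall, dist_pi_le_iff hε₀]
    intro i
    have := hε _ hx _ hx₀' (fun j hj => by rw [he2 x y ⟨j, hj⟩, he2 x₀ y ⟨j, hj⟩]) i i.2
    rwa [he1, he1] at this
  refine (lintegral_mono h2).trans ?_
  rw [lintegral_indicator measurableSet_closedBall, setLIntegral_const, mul_comm,
    volume_pi_real_closedBall _ hn₀]

theorem measurePreserving_uncurry_real (ι κ : Type*) [Fintype ι] [Fintype κ] :
    MeasurePreserving (Function.uncurry : (ι → κ → ℝ) → ι × κ → ℝ) := by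
  refine ⟨measurable_uncurry, (Measure.pi_eq fun s hs => ?_).symm⟩
  rw [Measure.map_apply measurable_uncurry (MeasurableSet.univ_pi hs)]
  have : (Function.uncurry : (ι → κ → ℝ) → ι × κ → ℝ) ⁻¹' (Set.univ.pi s) =
      Set.univ.pi fun i => Set.univ.pi fun j => s (i, j) := by
    ext w; simp [Function.uncurry]
  rw [this, volume_pi_pi, Fintype.prod_prod_type]
  simp_rw [volume_pi_pi]

theorem volume_le_of_determined₂ {ι κ : Type*} [Fintype ι] [Fintype κ] (q : ι → κ → Prop)
    [∀ i, DecidablePred (q i)]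
    {S : Set (ι → κ → ℝ)} (hS : MeasurableSet S) {n ε : ℝ} (hn₀ : 0 ≤ n) (hε₀ : 0 ≤ ε)
    (hn : ∀ w ∈ S, ∀ i j, |w i j| ≤ n)
    (hε : ∀ w ∈ S, ∀ w' ∈ S, (∀ i j, ¬ q i j → w i j = w' i j) →
      ∀ i j, q i j → |w i j - w' i j| ≤ ε) :
    volume S ≤ ENNReal.ofReal (2 * n) ^ Fintype.card {i : ι × κ // ¬ q i.1 i.2} *
      ENNReal.ofReal (2 * ε) ^ Fintype.card {i : ι × κ // q i.1 i.2} := by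
  have hS' : MeasurableSet ((Function.curry : (ι × κ → ℝ) → ι → κ → ℝ) ⁻¹' S) :=
    measurable_curry hS
  have h := (measurePreserving_uncurry_real ι κ).measure_preimage hS'.nullMeasurableSet
  have h' : (Function.uncurry : (ι → κ → ℝ) → ι × κ → ℝ) ⁻¹'
      ((Function.curry : (ι × κ → ℝ) → ι → κ → ℝ) ⁻¹' S) = S := by
    ext w; simp
  rw [h'] at h
  rw [h]
  refine volume_le_of_determined (fun i : ι × κ => q i.1 i.2) hS' hn₀ hε₀
    (fun w hw i => hn _ hw i.1 i.2) (fun w hw w' hw' h i hi => ?_)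
  exact hε _ hw _ hw' (fun i j hij => h (i, j) hij) i.1 i.2 hi

/-- Real and imaginary parts occupy transposed positions in the coordinate array, so row and column
`p` together hold exactly the `2 * N - 1` real parameters of the `p`-th row of a Hermitian matrix.
-/
theorem card_cross (N : ℕ) (p : Fin N) :
    Fintype.card {i : Fin N × Fin N // i.1 = p ∨ i.2 = p} + 1 = 2 * N := by
  have h : (Finset.univ.filter fun i : Fin N × Fin N => i.1 = p ∨ i.2 = p) =
      (({p} : Finset (Fin N)) ×ˢ Finset.univ) ∪
        ((Finset.univ.erase p) ×ˢ ({p} : Finset (Fin N))) := by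
    ext ⟨i, j⟩
    by_cases hi : i = p
    · simp [hi]
    · simp [Ne.symm hi, eq_comm]
  have := p.2
  rw [Fintype.card_subtype, h, Finset.card_union_of_disjoint, Finset.card_product,
    Finset.card_product, Finset.card_erase_of_mem (Finset.mem_univ _)]
  · simp; omega
  · rw [Finset.disjoint_left]
    rintro ⟨i, j⟩ h1 h2
    simp only [Finset.mem_product, Finset.mem_singleton, Finset.mem_univ, and_true,
      Finset.mem_erase, ne_eq] at h1 h2
    exact h2.1 h1

theorem card_off_two (N : ℕ) {p q : Fin N} (h : p ≠ q) :
    Fintype.card {k : Fin N // k ≠ p ∧ k ≠ q} + 2 = N := by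
  have h' : (Finset.univ.filter fun k : Fin N => k ≠ p ∧ k ≠ q) = Finset.univ \ {p, q} := by
    ext k; simp
  have := Finset.card_le_univ ({p, q} : Finset (Fin N))
  rw [Finset.card_pair h, Fintype.card_fin] at this
  rw [Fintype.card_subtype, h', Finset.card_sdiff_of_subset (Finset.subset_univ _),
    Finset.card_pair h, Finset.card_univ, Fintype.card_fin]
  omega

/-! ### Approximate eigenvectors from small gaps. -/

namespace HermMat

variable {N : ℕ}

/-- Two eigenvalues at distance at most `δ` give an approximate eigenvector with a prescribed zero
entry. -/
theorem exists_approx_eigenvector {M : HermMat N} {δ : ℝ} (h : M.MinGapLE δ) (q : Fin N) :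
    ∃ p, p ≠ q ∧ ∃ (c : ℝ) (u : Fin N → ℂ), u p = 1 ∧ u q = 0 ∧ (∀ k, ‖u k‖ ≤ 1) ∧
      ∀ k, ‖∑ l, (M : Matrix (Fin N) (Fin N) ℂ) k l * u l - c * u k‖ ≤ N * δ := by
  obtain ⟨i, j, hij, hgap⟩ := h
  have hδ : 0 ≤ δ := (abs_nonneg _).trans hgap
  obtain ⟨b, hb⟩ := M.exists_eigenbasis
  -- One linear condition on the plane spanned by two eigenvectors; this freedom to kill entry `q`
  -- removes two real parameters and is the source of the exponent `2`.
  obtain ⟨s, t, hst, hq⟩ : ∃ s t : ℂ, (s ≠ 0 ∨ t ≠ 0) ∧ s * b i q + t * b j q = 0 := by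
    by_cases h0 : b j q = 0
    · exact ⟨0, 1, by simp, by simp [h0]⟩
    · exact ⟨b j q, -b i q, Or.inl h0, by ring⟩
  set x : EuclideanSpace ℂ (Fin N) := s • b i + t • b j with hx
  have hxq : x q = 0 := by simpa [hx] using hq
  have hbi : inner ℂ (b i) x = s := by
    simp [hx, b.inner_eq_ite, hij]
  have hbj : inner ℂ (b j) x = t := by
    simp [hx, b.inner_eq_ite, hij.symm]
  have hx0 : x ≠ 0 := by
    intro h0
    rw [h0, inner_zero_right] at hbi hbj
    rcases hst with h | h
    · exact h hbi.symm
    · exact h hbj.symm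
  have ht : ‖t‖ ≤ ‖x‖ := by
    rw [← hbj]
    simpa using norm_inner_le_norm (𝕜 := ℂ) (b j) x
  obtain ⟨p, -, hp⟩ := Finset.exists_max_image Finset.univ (fun k => ‖x k‖) ⟨i, Finset.mem_univ _⟩
  have hp' : ∀ k, ‖x k‖ ≤ ‖x p‖ := fun k => hp k (Finset.mem_univ k)
  have hxp : x p ≠ 0 := by
    intro h0
    apply hx0
    ext k
    simpa [h0] using hp' k
  have hxp' : 0 < ‖x p‖ := norm_pos_iff.2 hxp
  have hxN : ‖x‖ ≤ N * ‖x p‖ := by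
    refine le_of_sq_le_sq ?_ (by positivity)
    rw [EuclideanSpace.norm_sq_eq]
    calc ∑ k, ‖x k‖ ^ 2 ≤ ∑ _k : Fin N, ‖x p‖ ^ 2 := by gcongr with k; exact hp' k
      _ = N * ‖x p‖ ^ 2 := by simp
      _ ≤ (N * N) * ‖x p‖ ^ 2 := by
        gcongr
        exact_mod_cast Nat.le_mul_self N
      _ = _ := by ring
  -- Subtracting the `i`-th eigenvalue leaves only the `b j` component, multiplied by the gap.
  have hMx : (M : Matrix (Fin N) (Fin N) ℂ).toEuclideanLin x - ((M.eig i : ℝ) : ℂ) • x =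
      (t * ((M.eig j - M.eig i : ℝ) : ℂ)) • b j := by
    rw [hx, map_add, map_smul, map_smul, hb, hb]
    push_cast
    module
  refine ⟨p, fun h => hxp (h ▸ hxq), M.eig i, fun k => x k / x p, div_self hxp, by simp [hxq],
    fun k => ?_, fun k => ?_⟩
  · rw [norm_div, div_le_one hxp']
    exact hp' k
  · have h1 := congrArg (fun v : EuclideanSpace ℂ (Fin N) => v k) hMx
    simp only [Matrix.toLpLin_apply, Matrix.mulVec, dotProduct, PiLp.sub_apply, PiLp.smul_apply,
      smul_eq_mul] at h1
    have h2 : ∑ l, (M : Matrix (Fin N) (Fin N) ℂ) k l * (x l / x p) - (M.eig i : ℂ) * (x k / x p)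
        = (t * ((M.eig j - M.eig i : ℝ) : ℂ)) * b j k / x p := by
      rw [← h1, sub_div, Finset.sum_div]
      congr 1
      · exact Finset.sum_congr rfl fun l _ => by ring
      · ring
    rw [h2, norm_div, div_le_iff₀ hxp', norm_mul, norm_mul, Complex.norm_real, Real.norm_eq_abs,
      abs_sub_comm]
    have hbk : ‖b j k‖ ≤ 1 := by
      simpa using PiLp.norm_apply_le (b j) k
    calc ‖t‖ * |M.eig i - M.eig j| * ‖b j k‖ ≤ (N * ‖x p‖) * δ * 1 := by
          gcongr
          exact ht.trans hxN
      _ = _ := by ring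

theorem norm_ofCoords_le {w : Fin N → Fin N → ℝ} {n : ℝ} (h : ∀ i j, |w i j| ≤ n) (i j : Fin N) :
    ‖(ofCoords w : Matrix (Fin N) (Fin N) ℂ) i j‖ ≤ 2 * n := by
  have hn : 0 ≤ n := (abs_nonneg _).trans (h i j)
  refine (Complex.norm_le_abs_re_add_abs_im _).trans ?_
  have h1 := h i j
  have h2 := h j i
  simp only [ofCoords, matrixOfCoords, Matrix.of_apply]
  split_ifs with h3 h4
  · simp; linarith
  · subst h4; simp; linarith
  · simp; linarith

theorem abs_le_norm_ofCoords (w : Fin N → Fin N → ℝ) (i j : Fin N) :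
    |w i j| ≤ ‖(ofCoords w : Matrix (Fin N) (Fin N) ℂ) i j‖ := by
  simp only [ofCoords, matrixOfCoords, Matrix.of_apply]
  split_ifs with h3 h4
  · refine le_of_eq_of_le ?_ (Complex.abs_re_le_norm _); simp
  · subst h4; simp
  · refine le_of_eq_of_le ?_ (Complex.abs_im_le_norm _); simp

theorem norm_ofCoords_comm (w : Fin N → Fin N → ℝ) (i j : Fin N) :
    ‖(ofCoords w : Matrix (Fin N) (Fin N) ℂ) i j‖ =
      ‖(ofCoords w : Matrix (Fin N) (Fin N) ℂ) j i‖ := by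
  rw [← (ofCoords w).isHermitian.apply i j, norm_star]

theorem ofCoords_apply_eq_zero {w : Fin N → Fin N → ℝ} {i j : Fin N} (h : w i j = 0)
    (h' : w j i = 0) : (ofCoords w : Matrix (Fin N) (Fin N) ℂ) i j = 0 := by
  simp only [ofCoords, matrixOfCoords, Matrix.of_apply]
  split_ifs with h3 h4 <;> simp_all

theorem continuous_ofCoords_apply (i j : Fin N) :
    Continuous fun w : Fin N → Fin N → ℝ => (ofCoords w : Matrix (Fin N) (Fin N) ℂ) i j := by
  simp only [ofCoords, matrixOfCoords, Matrix.of_apply]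
  split_ifs <;> fun_prop

/-- The volume of the set of bounded Hermitian matrices with a given approximate eigenvector and
eigenvalue. -/
theorem volume_approx_eigenvector_le (p : Fin N) {u : Fin N → ℂ} (hu : u p = 1)
    (hu2 : ∀ k, ‖u k‖ ≤ 2) (c : ℝ) {n ε : ℝ} (hn : 0 ≤ n) (hε : 0 ≤ ε) :
    volume {w : Fin N → Fin N → ℝ | (∀ i j, |w i j| ≤ n) ∧
        ∀ k, ‖∑ l, (ofCoords w : Matrix (Fin N) (Fin N) ℂ) k l * u l - c * u k‖ ≤ ε} ≤
      ENNReal.ofReal (2 * n) ^ Fintype.card {i : Fin N × Fin N // ¬ (i.1 = p ∨ i.2 = p)} *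
      ENNReal.ofReal (2 * (2 * ε + N * (4 * ε))) ^
        Fintype.card {i : Fin N × Fin N // i.1 = p ∨ i.2 = p} := by
  refine volume_le_of_determined₂ (fun i j => i = p ∨ j = p) ?_ hn (by positivity)
    (fun w hw => hw.1) ?_
  · refine IsClosed.measurableSet ?_
    simp only [Set.ofPred_and, Set.ofPred_forall]
    refine (isClosed_iInter fun i => isClosed_iInter fun j => ?_).inter (isClosed_iInter fun k => ?_)
    · exact isClosed_le (by fun_prop) continuous_const
    · refine isClosed_le (Continuous.norm (Continuous.sub (continuous_finsetSum _ fun l _ => ?_)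
        continuous_const)) continuous_const
      exact (continuous_ofCoords_apply k l).mul continuous_const
  · rintro w ⟨-, hw⟩ w' ⟨-, hw'⟩ heq
    have hD : ∀ k, ‖∑ l, (ofCoords (w - w') : Matrix (Fin N) (Fin N) ℂ) k l * u l‖ ≤ 2 * ε := by
      intro k
      have : ∑ l, (ofCoords (w - w') : Matrix (Fin N) (Fin N) ℂ) k l * u l =
          (∑ l, (ofCoords w : Matrix (Fin N) (Fin N) ℂ) k l * u l - c * u k) -
          (∑ l, (ofCoords w' : Matrix (Fin N) (Fin N) ℂ) k l * u l - c * u k) := by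
        simp only [ofCoords_sub, AddSubgroupClass.coe_sub, Matrix.sub_apply, sub_mul,
          Finset.sum_sub_distrib]
        ring
      rw [this]
      refine (norm_sub_le _ _).trans ?_
      linarith [hw k, hw' k]
    -- The difference of two solutions is supported on the cross at `p`. Hence row `k ≠ p` of its
    -- product with `u` is the single entry `(k, p)`, because `u p = 1`; hermiticity then controls
    -- row `p`, and its equation gives the diagonal entry.
    have hz : ∀ k l, k ≠ p → l ≠ p →
        (ofCoords (w - w') : Matrix (Fin N) (Fin N) ℂ) k l = 0 := by
      intro k l hk hl
      refine ofCoords_apply_eq_zero ?_ ?_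
      · simpa [sub_eq_zero] using heq k l (by tauto)
      · simpa [sub_eq_zero] using heq l k (by tauto)
    have hcol : ∀ k, k ≠ p → ‖(ofCoords (w - w') : Matrix (Fin N) (Fin N) ℂ) k p‖ ≤ 2 * ε := by
      intro k hk
      have h := hD k
      rwa [Finset.sum_eq_single p (fun l _ hl => by rw [hz k l hk hl, zero_mul]) (by simp), hu,
        mul_one] at h
    have hpp : ‖(ofCoords (w - w') : Matrix (Fin N) (Fin N) ℂ) p p‖ ≤ 2 * ε + N * (4 * ε) := by
      have h := hD p
      rw [← Finset.add_sum_erase _ _ (Finset.mem_univ p), hu, mul_one] at h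
      have h2 : ‖∑ l ∈ Finset.univ.erase p,
          (ofCoords (w - w') : Matrix (Fin N) (Fin N) ℂ) p l * u l‖ ≤ N * (4 * ε) := by
        refine (norm_sum_le_of_le _ (f := fun l =>
          (ofCoords (w - w') : Matrix (Fin N) (Fin N) ℂ) p l * u l) (n := fun _ => 4 * ε)
          fun l hl => ?_).trans ?_
        · rw [norm_mul, norm_ofCoords_comm]
          nlinarith [hcol l (Finset.ne_of_mem_erase hl), hu2 l, norm_nonneg (u l)]
        · rw [Finset.sum_const, nsmul_eq_mul]
          have : ((Finset.univ.erase p).card : ℝ) ≤ N := by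
            exact_mod_cast (Finset.card_le_univ _).trans_eq (Fintype.card_fin N)
          gcongr
      have h3 := norm_sub_le ((ofCoords (w - w') : Matrix (Fin N) (Fin N) ℂ) p p +
        ∑ l ∈ Finset.univ.erase p, (ofCoords (w - w') : Matrix (Fin N) (Fin N) ℂ) p l * u l)
        (∑ l ∈ Finset.univ.erase p, (ofCoords (w - w') : Matrix (Fin N) (Fin N) ℂ) p l * u l)
      rw [add_sub_cancel_right] at h3
      linarith
    have hNε : (0 : ℝ) ≤ N * (4 * ε) := by positivity
    intro i j hij
    refine (abs_le_norm_ofCoords (w - w') i j).trans ?_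
    by_cases hi : i = p
    · by_cases hj : j = p
      · rw [hi, hj]; exact hpp
      · rw [hi, norm_ofCoords_comm]
        linarith [hcol j hj]
    · have hj : j = p := hij.resolve_left hi
      rw [hj]
      linarith [hcol i hi]

end HermMat
end

/-! ### Double counting of matrices and approximate eigenpairs. -/

noncomputable section

namespace HermMat

variable {N : ℕ}

/-- The vector with entry `1` at `p`, entry `0` at `q`, and the given other entries. -/
def pinnedVec (p q : Fin N) (y : {k : Fin N // k ≠ p ∧ k ≠ q} → ℂ) (k : Fin N) : ℂ :=
  if h : k ≠ p ∧ k ≠ q then y ⟨k, h⟩ else if k = p then 1 else 0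

theorem pinnedVec_self (p q : Fin N) (y : {k : Fin N // k ≠ p ∧ k ≠ q} → ℂ) :
    pinnedVec p q y p = 1 := by simp [pinnedVec]

theorem continuous_pinnedVec (p q : Fin N) (k : Fin N) :
    Continuous fun y : {k : Fin N // k ≠ p ∧ k ≠ q} → ℂ => pinnedVec p q y k := by
  unfold pinnedVec
  split_ifs <;> fun_prop

theorem norm_pinnedVec_sub_le {p q : Fin N} {y y' : {k : Fin N // k ≠ p ∧ k ≠ q} → ℂ} {δ : ℝ}
    (h : dist y y' ≤ δ) (k : Fin N) : ‖pinnedVec p q y k - pinnedVec p q y' k‖ ≤ δ := by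
  have hδ : 0 ≤ δ := dist_nonneg.trans h
  unfold pinnedVec
  split_ifs with h1 h2
  · rw [← dist_eq_norm]
    exact (dist_le_pi_dist y y' _).trans h
  · simpa using hδ
  · simpa using hδ

theorem pinnedVec_restrict {p q : Fin N} {u : Fin N → ℂ} (hp : u p = 1)
    (hq : u q = 0) : pinnedVec p q (fun k => u k) = u := by
  ext k
  unfold pinnedVec
  split_ifs with h1 h2
  · rfl
  · rw [h2, hp]
  · have : k = q := by tauto
    rw [this, hq]

/-- Pairs of a bounded Hermitian matrix and an approximate eigenvalue and eigenvector. -/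
def approxEigen (p q : Fin N) (n R ε : ℝ) :
    Set ((Fin N → Fin N → ℝ) × (ℝ × ({k : Fin N // k ≠ p ∧ k ≠ q} → ℂ))) :=
  {x | (∀ i j, |x.1 i j| ≤ n) ∧ x.2 ∈ Metric.closedBall 0 R ∧ (∀ k, ‖pinnedVec p q x.2.2 k‖ ≤ 2) ∧
    ∀ k, ‖∑ l, (ofCoords x.1 : Matrix (Fin N) (Fin N) ℂ) k l * pinnedVec p q x.2.2 l -
      x.2.1 * pinnedVec p q x.2.2 k‖ ≤ ε}

theorem measurableSet_approxEigen (p q : Fin N) (n R ε : ℝ) :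
    MeasurableSet (approxEigen p q n R ε) := by
  have hv : ∀ k, Continuous fun x : (Fin N → Fin N → ℝ) ×
      (ℝ × ({k : Fin N // k ≠ p ∧ k ≠ q} → ℂ)) => pinnedVec p q x.2.2 k := fun k =>
    (continuous_pinnedVec p q k).comp (continuous_snd.comp continuous_snd)
  refine IsClosed.measurableSet ?_
  simp only [approxEigen, Set.ofPred_and, Set.ofPred_forall]
  refine (isClosed_iInter fun i => isClosed_iInter fun j => ?_).inter
    (IsClosed.inter ?_ ((isClosed_iInter fun k => ?_).inter (isClosed_iInter fun k => ?_)))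
  · exact isClosed_le (by fun_prop) continuous_const
  · exact Metric.isClosed_closedBall.preimage continuous_snd
  · exact isClosed_le (hv k).norm continuous_const
  · refine isClosed_le (Continuous.norm (Continuous.sub (continuous_finsetSum _ fun l _ => ?_)
      (Continuous.mul ?_ (hv k)))) continuous_const
    · exact ((continuous_ofCoords_apply k l).comp continuous_fst).mul (hv l)
    · fun_prop

/-- Moving the eigenpair by `δ` changes the residual by `O(N * n * δ)`, so approximate eigenpairs
come in whole `δ`-balls. The entry bound rises from `1` to `2` because `δ < 1`. -/
theorem mem_approxEigen_of_dist_le {p q : Fin N} {w : Fin N → Fin N → ℝ} {n δ : ℝ}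
    (hn : 1 ≤ n) (hδ0 : 0 < δ) (hδ1 : δ < 1) (hN : 1 ≤ N) (hw : ∀ i j, |w i j| ≤ n)
    {c₀ : ℝ} {y₀ : {k : Fin N // k ≠ p ∧ k ≠ q} → ℂ} (hu : ∀ k, ‖pinnedVec p q y₀ k‖ ≤ 1)
    (h : ∀ k, ‖∑ l, (ofCoords w : Matrix (Fin N) (Fin N) ℂ) k l * pinnedVec p q y₀ l -
      c₀ * pinnedVec p q y₀ k‖ ≤ N * δ)
    {z : ℝ × ({k : Fin N // k ≠ p ∧ k ≠ q} → ℂ)} (hz : z ∈ Metric.closedBall (c₀, y₀) δ) :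
    (w, z) ∈ approxEigen p q n (4 * N * n) (9 * N * n * δ) := by
  obtain ⟨c, y⟩ := z
  have hN' : (1 : ℝ) ≤ N := by exact_mod_cast hN
  have hNn : (1 : ℝ) ≤ N * n := by nlinarith
  rw [Metric.mem_closedBall, Prod.dist_eq, max_le_iff] at hz
  obtain ⟨hc, hy⟩ := hz
  simp only [Real.dist_eq] at hc hy
  have hM := norm_ofCoords_le hw
  have hsum : ∀ (v : Fin N → ℂ) (r : ℝ), 0 ≤ r → (∀ l, ‖v l‖ ≤ r) → ∀ k,
      ‖∑ l, (ofCoords w : Matrix (Fin N) (Fin N) ℂ) k l * v l‖ ≤ N * (2 * n * r) := by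
    intro v r hr hv k
    refine (norm_sum_le_of_le _ (f := fun l =>
      (ofCoords w : Matrix (Fin N) (Fin N) ℂ) k l * v l) (n := fun _ => 2 * n * r)
      fun l _ => ?_).trans (by simp)
    rw [norm_mul]
    exact mul_le_mul (hM k l) (hv l) (norm_nonneg _) (by linarith)
  -- Row `p` reads off `c₀` because the vector has entry `1` there.
  have hc0 : |c₀| ≤ 2 * (N * n) + N := by
    have h1 := h p
    rw [pinnedVec_self, mul_one] at h1
    have h2 := hsum _ 1 zero_le_one hu p
    have h3 := norm_sub_norm_le (c₀ : ℂ)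
      (∑ l, (ofCoords w : Matrix (Fin N) (Fin N) ℂ) p l * pinnedVec p q y₀ l)
    rw [norm_sub_rev, Complex.norm_real, Real.norm_eq_abs] at h3
    nlinarith
  have hNle : (N : ℝ) ≤ N * n := by nlinarith
  have hu' : ∀ k, ‖pinnedVec p q y k - pinnedVec p q y₀ k‖ ≤ δ := norm_pinnedVec_sub_le hy
  have hy0 : ∀ k, ‖y₀ k‖ ≤ 1 := fun k => by simpa [pinnedVec, k.2] using hu k
  refine ⟨hw, ?_, fun k => ?_, fun k => ?_⟩
  · rw [mem_closedBall_zero_iff, Prod.norm_def, max_le_iff, pi_norm_le_iff_of_nonneg (by positivity)]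
    constructor
    · rw [Real.norm_eq_abs]
      have := abs_sub_abs_le_abs_sub c c₀
      linarith
    · intro k
      have h1 := (dist_le_pi_dist y y₀ k).trans hy
      rw [dist_eq_norm] at h1
      have h2 := norm_sub_norm_le (y k) (y₀ k)
      have h3 := hy0 k
      simp only
      linarith
  · have h2 := norm_sub_norm_le (pinnedVec p q y k) (pinnedVec p q y₀ k)
    linarith [hu k, hu' k]
  -- The four terms are at most `N * δ`, `2 * N * n * δ`, `δ` and `4 * N * n * δ`, which fits under
  -- `9 * N * n * δ`.
  · have key : ∑ l, (ofCoords w : Matrix (Fin N) (Fin N) ℂ) k l * pinnedVec p q y l -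
        c * pinnedVec p q y k =
        (∑ l, (ofCoords w : Matrix (Fin N) (Fin N) ℂ) k l * pinnedVec p q y₀ l -
          c₀ * pinnedVec p q y₀ k) +
        ∑ l, (ofCoords w : Matrix (Fin N) (Fin N) ℂ) k l *
          (pinnedVec p q y l - pinnedVec p q y₀ l) -
        ((c - c₀ : ℝ) : ℂ) * pinnedVec p q y₀ k
          - c * (pinnedVec p q y k - pinnedVec p q y₀ k) := by
      simp only [mul_sub, Finset.sum_sub_distrib]
      push_cast
      ring
    have h1 := h k
    have h2 := hsum _ δ hδ0.le hu' k
    have h3 : ‖((c - c₀ : ℝ) : ℂ) * pinnedVec p q y₀ k‖ ≤ δ := by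
      rw [norm_mul, Complex.norm_real, Real.norm_eq_abs]
      nlinarith [hu k, norm_nonneg (pinnedVec p q y₀ k), abs_nonneg (c - c₀)]
    have h4 : ‖(c : ℂ) * (pinnedVec p q y k - pinnedVec p q y₀ k)‖ ≤ 4 * (N * n) * δ := by
      rw [norm_mul, Complex.norm_real, Real.norm_eq_abs]
      have h5 : |c| ≤ 4 * (N * n) := by
        have := abs_sub_abs_le_abs_sub c c₀
        linarith
      exact mul_le_mul h5 (hu' k) (norm_nonneg _) (by linarith)
    simp only
    rw [key]
    refine (norm_sub_le _ _).trans ?_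
    have h6 := norm_sub_le ((∑ l, (ofCoords w : Matrix (Fin N) (Fin N) ℂ) k l *
          pinnedVec p q y₀ l - c₀ * pinnedVec p q y₀ k) +
        ∑ l, (ofCoords w : Matrix (Fin N) (Fin N) ℂ) k l *
          (pinnedVec p q y l - pinnedVec p q y₀ l))
        (((c - c₀ : ℝ) : ℂ) * pinnedVec p q y₀ k)
    have h7 := norm_add_le (∑ l, (ofCoords w : Matrix (Fin N) (Fin N) ℂ) k l *
          pinnedVec p q y₀ l - c₀ * pinnedVec p q y₀ k)
        (∑ l, (ofCoords w : Matrix (Fin N) (Fin N) ℂ) k l *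
          (pinnedVec p q y l - pinnedVec p q y₀ l))
    nlinarith

theorem finrank_params {p q : Fin N} (hpq : p ≠ q) :
    Module.finrank ℝ (ℝ × ({k : Fin N // k ≠ p ∧ k ≠ q} → ℂ)) + 3 = 2 * N := by
  have := card_off_two N hpq
  rw [Module.finrank_prod, Module.finrank_pi_fintype]
  simp only [Module.finrank_self, Complex.finrank_real_complex, Finset.sum_const, Finset.card_univ,
    smul_eq_mul]
  omega

/-- The incidence set `approxEigen` is measured by Fubini in both orders. Slices at a fixed
eigenpair have volume `O(δ ^ (2 * N - 1))`, while slices at a matrix of the set in question contain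
a `δ`-ball in dimension `2 * N - 3`; Markov's inequality compares the two. -/
theorem volume_minGapLE_pivot_le {p q : Fin N} (hpq : p ≠ q) {n δ : ℝ} (hn : 1 ≤ n)
    (hδ0 : 0 < δ) (hδ1 : δ < 1) (hN : 1 ≤ N) :
    volume {w : Fin N → Fin N → ℝ | (∀ i j, |w i j| ≤ n) ∧ ∃ (c : ℝ) (u : Fin N → ℂ),
        u p = 1 ∧ u q = 0 ∧ (∀ k, ‖u k‖ ≤ 1) ∧
        ∀ k, ‖∑ l, (ofCoords w : Matrix (Fin N) (Fin N) ℂ) k l * u l - c * u k‖ ≤ N * δ} ≤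
      ENNReal.ofReal ((4 * N * n) ^ (2 * N - 3) *
        ((2 * n) ^ Fintype.card {i : Fin N × Fin N // ¬ (i.1 = p ∨ i.2 = p)} *
          (36 * N * (2 * N + 1) * n) ^ (2 * N - 1)) * δ ^ 2) := by
  let Y := ℝ × ({k : Fin N // k ≠ p ∧ k ≠ q} → ℂ)
  have hpi : (volume : Measure ({k : Fin N // k ≠ p ∧ k ≠ q} → ℂ)).IsAddHaarMeasure := by
    rw [volume_pi]; infer_instance
  have hHaar : (volume : Measure Y).IsAddHaarMeasure :=
    inferInstanceAs ((volume : Measure ℝ).prod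
      (volume : Measure ({k : Fin N // k ≠ p ∧ k ≠ q} → ℂ))).IsAddHaarMeasure
  set d := Module.finrank ℝ Y with hd
  have hdN : d + 3 = 2 * N := finrank_params hpq
  have hN' : (1 : ℝ) ≤ N := by exact_mod_cast hN
  set T := approxEigen p q n (4 * N * n) (9 * N * n * δ) with hT
  have hTm : MeasurableSet T := measurableSet_approxEigen p q _ _ _
  set V : ℝ≥0∞ := volume (Metric.ball (0 : Y) 1) with hV
  have hV0 : V ≠ 0 := (Metric.measure_ball_pos volume (0 : Y) one_pos).ne'
  have hVt : V ≠ ∞ := measure_ball_lt_top.ne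
  have hball : ∀ (z : Y) {r : ℝ}, 0 ≤ r →
      volume (Metric.closedBall z r) = ENNReal.ofReal (r ^ d) * V := fun z r hr =>
    Measure.addHaar_closedBall volume z hr
  have hnn : 0 ≤ n := by linarith
  set A : ℝ := (2 * n) ^ Fintype.card {i : Fin N × Fin N // ¬ (i.1 = p ∨ i.2 = p)} *
    (36 * N * (2 * N + 1) * n * δ) ^ (2 * N - 1) with hA
  have hA0 : 0 ≤ A := by positivity
  have hsec : ∀ z : Y, volume ((fun w => (w, z)) ⁻¹' T) ≤
      (Metric.closedBall (0 : Y) (4 * N * n)).indicator (fun _ => ENNReal.ofReal A) z := by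
    intro z
    rcases Set.eq_empty_or_nonempty ((fun w => (w, z)) ⁻¹' T) with h | ⟨w₀, hw₀⟩
    · rw [h]; simp
    have hw₀' : (w₀, z) ∈ T := hw₀
    rw [Set.indicator_of_mem hw₀'.2.1]
    have hε : (0 : ℝ) ≤ 9 * N * n * δ := by positivity
    refine (measure_mono ?_).trans ((volume_approx_eigenvector_le p (pinnedVec_self p q z.2)
      hw₀'.2.2.1 z.1 hnn hε).trans ?_)
    · rintro w ⟨h1, -, -, h2⟩
      exact ⟨h1, h2⟩
    · have hcard := card_cross N p
      rw [← ENNReal.ofReal_pow (by positivity), ← ENNReal.ofReal_pow (by positivity),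
        ← ENNReal.ofReal_mul (by positivity), hA,
        show Fintype.card {i : Fin N × Fin N // i.1 = p ∨ i.2 = p} = 2 * N - 1 by omega,
        show 2 * (2 * (9 * N * n * δ) + N * (4 * (9 * N * n * δ))) = 36 * N * (2 * N + 1) * n * δ by
          ring]
  have hprod : (volume.prod volume) T ≤ ENNReal.ofReal ((4 * N * n) ^ d) * V * ENNReal.ofReal A := by
    rw [Measure.prod_apply_symm hTm]
    refine (lintegral_mono hsec).trans ?_
    rw [lintegral_indicator measurableSet_closedBall, setLIntegral_const,
      hball 0 (by positivity : (0 : ℝ) ≤ 4 * N * n), mul_comm]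
  have hlow : ENNReal.ofReal (δ ^ d) * V *
      volume {w | ENNReal.ofReal (δ ^ d) * V ≤ volume (Prod.mk w ⁻¹' T)} ≤
      (volume.prod volume) T := by
    rw [Measure.prod_apply hTm]
    exact mul_meas_ge_le_lintegral (measurable_measure_prodMk_left hTm) _
  have hsub : {w : Fin N → Fin N → ℝ | (∀ i j, |w i j| ≤ n) ∧ ∃ (c : ℝ) (u : Fin N → ℂ),
        u p = 1 ∧ u q = 0 ∧ (∀ k, ‖u k‖ ≤ 1) ∧
        ∀ k, ‖∑ l, (ofCoords w : Matrix (Fin N) (Fin N) ℂ) k l * u l - c * u k‖ ≤ N * δ} ⊆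
      {w | ENNReal.ofReal (δ ^ d) * V ≤ volume (Prod.mk w ⁻¹' T)} := by
    rintro w ⟨hw, c, u, hup, huq, hu1, hu⟩
    rw [← pinnedVec_restrict hup huq] at hu1 hu
    rw [Set.mem_ofPred_eq, ← hball (c, fun k => u k) hδ0.le]
    exact measure_mono fun z hz => mem_approxEigen_of_dist_le hn hδ0 hδ1 hN hw hu1 hu hz
  have hmain := (mul_le_mul_right (measure_mono hsub) (ENNReal.ofReal (δ ^ d) * V)).trans
    (hlow.trans hprod)
  have hδd : 0 < δ ^ d := by positivity
  have hne0 : ENNReal.ofReal (δ ^ d) * V ≠ 0 := mul_ne_zero (by simpa using hδd) hV0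
  have hnet : ENNReal.ofReal (δ ^ d) * V ≠ ∞ := ENNReal.mul_ne_top ENNReal.ofReal_ne_top hVt
  rw [← ENNReal.mul_le_mul_iff_right hne0 hnet]
  refine hmain.trans (le_of_eq ?_)
  rw [mul_right_comm, ← ENNReal.ofReal_mul (by positivity), mul_right_comm (ENNReal.ofReal (δ ^ d)),
    ← ENNReal.ofReal_mul (by positivity)]
  congr 2
  -- The quotient of the two powers of `δ`. The natural subtractions do not truncate, since `d + 3 =
  -- 2 * N`.
  rw [hA, mul_pow _ δ, show 2 * N - 1 = d + 2 by omega, show 2 * N - 3 = d by omega]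
  ring

/-- The volume of the set of bounded Hermitian matrices with a gap of size at most `δ`. -/
theorem exists_volume_minGapLE_le (N : ℕ) : ∃ (C : ℝ) (m : ℕ), 0 ≤ C ∧
    ∀ n δ : ℝ, 1 ≤ n → 0 < δ → δ < 1 →
      volume {w : Fin N → Fin N → ℝ | (∀ i j, |w i j| ≤ n) ∧ (ofCoords w).MinGapLE δ} ≤
        ENNReal.ofReal (C * n ^ m * δ ^ 2) := by
  rcases Nat.eq_zero_or_pos N with rfl | hN
  · refine ⟨0, 0, le_rfl, fun n δ _ _ _ => ?_⟩
    have : {w : Fin 0 → Fin 0 → ℝ | (∀ i j, |w i j| ≤ n) ∧ (ofCoords w).MinGapLE δ} = ∅ := by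
      ext w
      simp [MinGapLE]
    rw [this]
    simp
  -- Any fixed index serves as the zero entry; for `N = 1` the union over `p ≠ q` below is empty.
  let q : Fin N := ⟨0, hN⟩
  let K : Fin N → ℕ := fun p => Fintype.card {i : Fin N × Fin N // ¬ (i.1 = p ∨ i.2 = p)}
  refine ⟨∑ p : Fin N, (4 * N) ^ (2 * N - 3) * (2 ^ K p * (36 * N * (2 * N + 1)) ^ (2 * N - 1)),
    (2 * N - 3) + (N * N + (2 * N - 1)), by positivity, fun n δ hn hδ0 hδ1 => ?_⟩
  have hsub : {w : Fin N → Fin N → ℝ | (∀ i j, |w i j| ≤ n) ∧ (ofCoords w).MinGapLE δ} ⊆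
      ⋃ p ∈ Finset.univ.filter (· ≠ q), {w : Fin N → Fin N → ℝ | (∀ i j, |w i j| ≤ n) ∧
        ∃ (c : ℝ) (u : Fin N → ℂ), u p = 1 ∧ u q = 0 ∧ (∀ k, ‖u k‖ ≤ 1) ∧
        ∀ k, ‖∑ l, (ofCoords w : Matrix (Fin N) (Fin N) ℂ) k l * u l - c * u k‖ ≤ N * δ} := by
    rintro w ⟨hw, hgap⟩
    obtain ⟨p, hpq, h⟩ := exists_approx_eigenvector hgap q
    simp only [Set.mem_iUnion]
    exact ⟨p, by simpa using hpq, hw, h⟩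
  refine (measure_mono hsub).trans ((measure_biUnion_finset_le _ _).trans ?_)
  have hterm : ∀ p, 0 ≤ (4 * N : ℝ) ^ (2 * N - 3) *
      (2 ^ K p * (36 * N * (2 * N + 1)) ^ (2 * N - 1)) *
      n ^ ((2 * N - 3) + (N * N + (2 * N - 1))) * δ ^ 2 := fun p => by positivity
  rw [Finset.sum_mul, Finset.sum_mul, ENNReal.ofReal_sum_of_nonneg fun p _ => hterm p]
  refine (Finset.sum_le_sum (fun p hp => ?_)).trans
    (Finset.sum_le_sum_of_subset (Finset.subset_univ _))
  refine (volume_minGapLE_pivot_le (by simpa using hp) hn hδ0 hδ1 hN).trans ?_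
  apply ENNReal.ofReal_le_ofReal
  have hK : K p ≤ N * N := (Fintype.card_subtype_le _).trans (by simp)
  have hpow : n ^ K p ≤ n ^ (N * N) := pow_le_pow_right₀ hn hK
  calc (4 * N * n) ^ (2 * N - 3) *
        ((2 * n) ^ K p * (36 * N * (2 * N + 1) * n) ^ (2 * N - 1)) * δ ^ 2
      = (4 * N : ℝ) ^ (2 * N - 3) *
      (2 ^ K p * (36 * N * (2 * N + 1)) ^ (2 * N - 1)) *
      (n ^ (2 * N - 3) * (n ^ K p * n ^ (2 * N - 1))) * δ ^ 2 := by
        rw [mul_pow _ n, mul_pow _ n, mul_pow _ n]; ring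
    _ ≤ (4 * N : ℝ) ^ (2 * N - 3) *
      (2 ^ K p * (36 * N * (2 * N + 1)) ^ (2 * N - 1)) *
      (n ^ (2 * N - 3) * (n ^ (N * N) * n ^ (2 * N - 1))) * δ ^ 2 := by gcongr
    _ = _ := by rw [pow_add, pow_add]

end HermMat
end

/-! ### Gaussian integration, gap probabilities and inverse gaps. -/

noncomputable section

namespace HermMat

variable {N : ℕ}

theorem sq_le_frobSq_ofCoords (w : Fin N → Fin N → ℝ) (i j : Fin N) :
    w i j ^ 2 ≤ (ofCoords w).frobSq := by
  rw [frobSq, ← sq_abs]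
  refine (pow_le_pow_left₀ (abs_nonneg _) (abs_le_norm_ofCoords w i j) 2).trans ?_
  refine (Finset.single_le_sum (f := fun l =>
    ‖(ofCoords w : Matrix (Fin N) (Fin N) ℂ) i l‖ ^ 2) (fun _ _ => by positivity)
    (Finset.mem_univ j)).trans ?_
  exact Finset.single_le_sum (f := fun k => ∑ l,
    ‖(ofCoords w : Matrix (Fin N) (Fin N) ℂ) k l‖ ^ 2) (fun _ _ => by positivity)
    (Finset.mem_univ i)

theorem frobSq_smul (r : ℝ) (M : HermMat N) : (r • M).frobSq = r ^ 2 * M.frobSq := by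
  simp [frobSq, Finset.mul_sum, mul_pow]

theorem summable_exp_neg_sq_mul_pow {b : ℝ} (hb : 0 < b) (m : ℕ) :
    Summable fun k : ℕ => Real.exp (-b * (k : ℝ) ^ 2) * ((k : ℝ) + 1) ^ m := by
  have h := ((summable_nat_add_iff 1).2 (Real.summable_pow_mul_exp_neg_nat_mul m hb)).mul_left
    (Real.exp b)
  refine h.of_nonneg_of_le (fun k => by positivity) fun k => ?_
  have h1 : Real.exp (-b * (k : ℝ) ^ 2) ≤ Real.exp b * Real.exp (-b * ((k + 1 : ℕ) : ℝ)) := by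
    rw [← Real.exp_add, Real.exp_le_exp]
    push_cast
    have : (k : ℝ) ≤ (k : ℝ) ^ 2 := by exact_mod_cast Nat.le_self_pow two_ne_zero k
    nlinarith
  calc _ ≤ (Real.exp b * Real.exp (-b * ((k + 1 : ℕ) : ℝ))) * ((k : ℝ) + 1) ^ m := by gcongr
    _ = _ := by push_cast; ring

/-- Gaussian integrals over sets of polynomial volume growth. -/
theorem exists_setLIntegral_exp_frobSq_le {b : ℝ} (hb : 0 < b) (m : ℕ) : ∃ K : ℝ, 0 ≤ K ∧
    ∀ (S : Set (Fin N → Fin N → ℝ)), MeasurableSet S → ∀ A : ℝ, 0 ≤ A →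
      (∀ n : ℝ, 1 ≤ n → volume {w | (∀ i j, |w i j| ≤ n) ∧ w ∈ S} ≤ ENNReal.ofReal (A * n ^ m)) →
      ∫⁻ w, S.indicator (fun w => ENNReal.ofReal (Real.exp (-b * (ofCoords w).frobSq))) w ≤
        ENNReal.ofReal (K * A) := by
  have hsum := summable_exp_neg_sq_mul_pow hb m
  refine ⟨∑' k : ℕ, Real.exp (-b * (k : ℝ) ^ 2) * ((k : ℝ) + 1) ^ m,
    tsum_nonneg fun k => by positivity, fun S hS A hA hvol => ?_⟩
  let B : ℕ → Set (Fin N → Fin N → ℝ) := fun k => {w | (∀ i j, |w i j| ≤ (k : ℝ) + 1) ∧ w ∈ S}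
  have hB : ∀ k, MeasurableSet (B k) := fun k => by
    have hBk : B k = (⋂ i, ⋂ j, {w | |w i j| ≤ (k : ℝ) + 1}) ∩ S := by
      ext w; simp [B]
    rw [hBk]
    refine MeasurableSet.inter ?_ hS
    refine IsClosed.measurableSet (isClosed_iInter fun i => isClosed_iInter fun j => ?_)
    exact isClosed_le (by fun_prop) continuous_const
  -- Layers by `k = ⌊‖w‖⌋` in Frobenius norm: the weight is at most `exp (-b * k ^ 2)`, and all
  -- coordinates are at most `k + 1`, where the volume hypothesis applies.
  have hpt : ∀ w, S.indicator
      (fun w => ENNReal.ofReal (Real.exp (-b * (ofCoords w).frobSq))) w ≤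
      ∑' k : ℕ, (B k).indicator (fun _ => ENNReal.ofReal (Real.exp (-b * (k : ℝ) ^ 2))) w := by
    intro w
    by_cases hw : w ∈ S
    · have hle : ∀ i j, |w i j| ≤ √(ofCoords w).frobSq := fun i j =>
        Real.abs_le_sqrt (sq_le_frobSq_ofCoords w i j)
      have hk : w ∈ B ⌊√(ofCoords w).frobSq⌋₊ :=
        ⟨fun i j => (hle i j).trans (Nat.lt_floor_add_one _).le, hw⟩
      refine le_trans ?_ (ENNReal.le_tsum ⌊√(ofCoords w).frobSq⌋₊)
      rw [Set.indicator_of_mem hw, Set.indicator_of_mem hk]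
      apply ENNReal.ofReal_le_ofReal
      rw [Real.exp_le_exp]
      have h1 : ((⌊√(ofCoords w).frobSq⌋₊ : ℕ) : ℝ) ^ 2 ≤ (ofCoords w).frobSq := by
        calc _ ≤ √(ofCoords w).frobSq ^ 2 := by
              gcongr; exact Nat.floor_le (Real.sqrt_nonneg _)
          _ = _ := Real.sq_sqrt (frobSq_nonneg _)
      nlinarith
    · rw [Set.indicator_of_notMem hw]; exact zero_le
  refine (lintegral_mono hpt).trans ?_
  rw [lintegral_tsum fun k => (measurable_const.indicator (hB k)).aemeasurable, ← tsum_mul_right,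
    ENNReal.ofReal_tsum_of_nonneg (fun k => by positivity) (hsum.mul_right A)]
  refine ENNReal.tsum_le_tsum fun k => ?_
  rw [lintegral_indicator (hB k), setLIntegral_const]
  refine (mul_le_mul_right (hvol ((k : ℝ) + 1) (by linarith [Nat.cast_nonneg (α := ℝ) k])) _).trans ?_
  rw [← ENNReal.ofReal_mul (by positivity)]
  apply ENNReal.ofReal_le_ofReal
  apply le_of_eq
  ring

theorem measurable_gueWeight : Measurable (gueWeight : HermMat N → ℝ≥0∞) :=
  (Real.measurable_exp.comp (measurable_frobSq.const_mul _)).ennreal_ofReal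

/-- The normalizing constant of the GUE. -/
def partition (N : ℕ) : ℝ≥0∞ := ∫⁻ w : Fin N → Fin N → ℝ, gueWeight (ofCoords w)

theorem lintegral_lebesgue {f : HermMat N → ℝ≥0∞} (hf : Measurable f) :
    ∫⁻ q, f q ∂(lebesgue N) = ∫⁻ w : Fin N → Fin N → ℝ, f (ofCoords w) :=
  lintegral_map hf measurable_ofCoords

theorem lintegral_gue {f : HermMat N → ℝ≥0∞} (hf : Measurable f) :
    ∫⁻ q, f q ∂(gue N) =
      (partition N)⁻¹ * ∫⁻ w : Fin N → Fin N → ℝ, gueWeight (ofCoords w) * f (ofCoords w) := by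
  rw [gue, lintegral_smul_measure, lintegral_withDensity_eq_lintegral_mul _ measurable_gueWeight hf,
    lintegral_lebesgue measurable_gueWeight, lintegral_lebesgue (measurable_gueWeight.mul hf)]
  rfl

theorem partition_ne_zero : partition N ≠ 0 := by
  have hm : Measurable fun w : Fin N → Fin N → ℝ => gueWeight (ofCoords w) :=
    measurable_gueWeight.comp measurable_ofCoords
  rw [partition, Ne, lintegral_eq_zero_iff hm]
  intro h
  have h2 : ∀ᵐ _w : Fin N → Fin N → ℝ, False := by
    filter_upwards [h] with w hw
    have : 0 < gueWeight (ofCoords w) := by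
      rw [gueWeight, ENNReal.ofReal_pos]; exact Real.exp_pos _
    exact this.ne' hw
  rw [Filter.eventually_false_iff_eq_bot, ae_eq_bot] at h2
  exact NeZero.ne _ h2

theorem partition_ne_top (hN : 1 ≤ N) : partition N ≠ ∞ := by
  have hN' : (1 : ℝ) ≤ N := by exact_mod_cast hN
  obtain ⟨K, -, hK⟩ := exists_setLIntegral_exp_frobSq_le (N := N)
    (b := (N : ℝ) / 2) (by positivity) (N * N)
  have h := hK Set.univ MeasurableSet.univ (2 ^ (N * N)) (by positivity) fun n hn => by
    have hsub : {w : Fin N → Fin N → ℝ | (∀ i j, |w i j| ≤ n) ∧ w ∈ Set.univ} ⊆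
        Set.univ.pi fun _ => Set.univ.pi fun _ => Metric.closedBall (0 : ℝ) n := by
      rintro w ⟨hw, -⟩ i - j -
      simpa using hw i j
    refine (measure_mono hsub).trans (le_of_eq ?_)
    simp only [volume_pi_pi, Real.volume_closedBall, Finset.prod_const, Finset.card_univ,
      Fintype.card_fin]
    rw [← pow_mul, ← ENNReal.ofReal_pow (by linarith), mul_pow]
  refine ne_top_of_le_ne_top ENNReal.ofReal_ne_top (le_trans (le_of_eq ?_) h)
  simp [partition, gueWeight]

theorem isProbabilityMeasure_gue (hN : 1 ≤ N) : IsProbabilityMeasure (gue N) := by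
  constructor
  rw [← lintegral_one, lintegral_gue measurable_const]
  simp only [mul_one]
  exact ENNReal.inv_mul_cancel partition_ne_zero (partition_ne_top hN)

theorem lintegral_comp_add_smul {f : (Fin N → Fin N → ℝ) → ℝ≥0∞} (hf : Measurable f)
    (v : Fin N → Fin N → ℝ) {s : ℝ} (hs : 0 < s) :
    ∫⁻ w, f (v + s • w) = ENNReal.ofReal ((s ^ (N * N))⁻¹) * ∫⁻ w, f w := by
  have hd : Module.finrank ℝ (Fin N → Fin N → ℝ) = N * N := by
    rw [Module.finrank_pi_fintype]; simp
  have h1 : ∫⁻ w, f (v + s • w) =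
      ∫⁻ w, f (v + w) ∂(Measure.map (s • ·) (volume : Measure (Fin N → Fin N → ℝ))) := by
    rw [lintegral_map (by fun_prop) (by fun_prop)]
  have hHaar : (volume : Measure (Fin N → Fin N → ℝ)).IsAddHaarMeasure := by
    have h2 : (volume : Measure (Fin N → ℝ)).IsAddHaarMeasure := by rw [volume_pi]; infer_instance
    rw [volume_pi]; infer_instance
  rw [h1, Measure.map_addHaar_smul volume hs.ne', hd, lintegral_smul_measure,
    lintegral_add_left_eq_self, abs_of_nonneg (by positivity), smul_eq_mul]

/-- Entrywise, `(y + x) ^ 2 ≤ 3 * (x ^ 2 / 2 + y ^ 2)`. Multiplied by `e^{2N} / 3`, the `x` part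
becomes `1/2` of the squared norm of `w`, dominated by the GUE exponent `N/2`, and the `y` part is
exactly the exponent of `psi`. -/
theorem gueWeight_ofCoords_le (hN : 1 ≤ N) (v w : Fin N → Fin N → ℝ) :
    gueWeight (ofCoords w) ≤ ENNReal.ofReal (psi (ofCoords v)) *
      ENNReal.ofReal (Real.exp (-(Real.exp (2 * (N : ℝ)) / 3) *
        (ofCoords (v + Real.exp (-(N : ℝ)) • w)).frobSq)) := by
  have hN' : (1 : ℝ) ≤ N := by exact_mod_cast hN
  rw [gueWeight, psi, ← ENNReal.ofReal_mul (by positivity), ← Real.exp_add]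
  apply ENNReal.ofReal_le_ofReal
  rw [Real.exp_le_exp]
  set s := Real.exp (-(N : ℝ)) with hs
  have hs2 : Real.exp (2 * (N : ℝ)) * s ^ 2 = 1 := by
    rw [hs, ← Real.exp_nat_mul, ← Real.exp_add, ← Real.exp_zero]; congr 1; push_cast; ring
  have key : (ofCoords (v + s • w)).frobSq ≤
      3 * ((1 / 2) * (s ^ 2 * (ofCoords w).frobSq) + (ofCoords v).frobSq) := by
    rw [← frobSq_smul]
    simp only [frobSq, Finset.mul_sum, ← Finset.sum_add_distrib, ofCoords_add, ofCoords_smul]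
    refine Finset.sum_le_sum fun i _ => Finset.sum_le_sum fun j _ => ?_
    have h := norm_add_le ((ofCoords v : Matrix (Fin N) (Fin N) ℂ) i j)
      (((s • ofCoords w : HermMat N) : Matrix (Fin N) (Fin N) ℂ) i j)
    rw [AddMemClass.coe_add, Matrix.add_apply]
    set x := ‖((s • ofCoords w : HermMat N) : Matrix (Fin N) (Fin N) ℂ) i j‖
    set y := ‖(ofCoords v : Matrix (Fin N) (Fin N) ℂ) i j‖
    calc _ ≤ (y + x) ^ 2 := by gcongr
      _ ≤ _ := by nlinarith [sq_nonneg (x - 2 * y)]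
  have hF := frobSq_nonneg (ofCoords w)
  have h3 : (Real.exp (2 * (N : ℝ)) / 3) * (ofCoords (v + s • w)).frobSq ≤
      (1 / 2) * ((Real.exp (2 * (N : ℝ)) * s ^ 2) * (ofCoords w).frobSq) +
        Real.exp (2 * (N : ℝ)) * (ofCoords v).frobSq := by
    have := mul_le_mul_of_nonneg_left key (by positivity : 0 ≤ Real.exp (2 * (N : ℝ)) / 3)
    linarith
  rw [hs2, one_mul] at h3
  nlinarith

/-- The law of the perturbed matrix has a density that is bounded by a multiple of a centred
Gaussian density. -/
theorem lintegral_perturb_gue_le (hN : 1 ≤ N) {f : HermMat N → ℝ≥0∞} (hf : Measurable f)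
    (P : HermMat N) :
    ∫⁻ q, f (P.perturb q) ∂(gue N) ≤ ENNReal.ofReal (psi P) *
      ((partition N)⁻¹ * (ENNReal.ofReal ((Real.exp (-(N : ℝ)) ^ (N * N))⁻¹) *
        ∫⁻ w : Fin N → Fin N → ℝ, ENNReal.ofReal (Real.exp (-(Real.exp (2 * (N : ℝ)) / 3) *
          (ofCoords w).frobSq)) * f (ofCoords w))) := by
  have hpert : Measurable fun q => f (P.perturb q) :=
    hf.comp (measurable_perturb.comp measurable_prodMk_left)
  have hmeas : Measurable fun w : Fin N → Fin N → ℝ =>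
      ENNReal.ofReal (Real.exp (-(Real.exp (2 * (N : ℝ)) / 3) *
          (ofCoords w).frobSq)) * f (ofCoords w) := by
    refine Measurable.mul ?_ (hf.comp measurable_ofCoords)
    exact (Real.measurable_exp.comp
      (continuous_frobSq_ofCoords.measurable.const_mul _)).ennreal_ofReal
  rw [lintegral_gue hpert, ← lintegral_comp_add_smul hmeas P.coords (Real.exp_pos _),
    mul_left_comm]
  gcongr
  rw [← lintegral_const_mul' _ _ ENNReal.ofReal_ne_top]
  refine lintegral_mono fun w => ?_
  have h := gueWeight_ofCoords_le hN P.coords w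
  have hp : P.perturb (ofCoords w) = ofCoords (P.coords + Real.exp (-(N : ℝ)) • w) := by
    rw [ofCoords_add, ofCoords_smul, ofCoords_coords, perturb]
  rw [ofCoords_coords] at h
  simp only
  rw [hp, ← mul_assoc]
  gcongr

/-- The probability of a gap of size at most `δ`. -/
theorem exists_gue_minGapLE_le (hN : 1 ≤ N) : ∃ c : ℝ, 0 ≤ c ∧ ∀ (P : HermMat N) (δ : ℝ),
    0 < δ → δ < 1 →
      gue N {q | (P.perturb q).MinGapLE δ} ≤ ENNReal.ofReal (c * P.psi * δ ^ 2) := by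
  obtain ⟨C, m, hC, hvol⟩ := exists_volume_minGapLE_le N
  obtain ⟨K, hK, hint⟩ := exists_setLIntegral_exp_frobSq_le (N := N)
    (b := Real.exp (2 * (N : ℝ)) / 3) (by positivity) m
  set z : ℝ := ((partition N)⁻¹).toReal with hz
  have hzZ : (partition N)⁻¹ = ENNReal.ofReal z :=
    (ENNReal.ofReal_toReal (ENNReal.inv_ne_top.2 partition_ne_zero)).symm
  have hz0 : 0 ≤ z := ENNReal.toReal_nonneg
  refine ⟨z * ((Real.exp (-(N : ℝ)) ^ (N * N))⁻¹ * (K * C)), by positivity,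
    fun P δ hδ0 hδ1 => ?_⟩
  have hM := measurableSet_minGapLE (N := N) δ
  have hpert : Measurable fun q => P.perturb q := measurable_perturb.comp measurable_prodMk_left
  have h1 : gue N {q | (P.perturb q).MinGapLE δ} =
      ∫⁻ q, ({M : HermMat N | M.MinGapLE δ}.indicator fun _ => 1) (P.perturb q) ∂(gue N) := by
    have hset : {q | (P.perturb q).MinGapLE δ} =
        (fun q => P.perturb q) ⁻¹' {M : HermMat N | M.MinGapLE δ} := rfl
    rw [hset, ← lintegral_indicator_one (hpert hM)]
    rfl
  rw [h1]
  refine (lintegral_perturb_gue_le hN (measurable_const.indicator hM) P).trans ?_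
  have h2 : ∫⁻ w : Fin N → Fin N → ℝ, ENNReal.ofReal (Real.exp (-(Real.exp (2 * (N : ℝ)) / 3) *
      (ofCoords w).frobSq)) * ({M : HermMat N | M.MinGapLE δ}.indicator (fun _ => 1)) (ofCoords w)
      ≤ ENNReal.ofReal (K * (C * δ ^ 2)) := by
    refine le_trans (le_of_eq ?_) (hint (ofCoords ⁻¹' {M : HermMat N | M.MinGapLE δ})
      (measurable_ofCoords hM) (C * δ ^ 2) (by positivity) fun n hn => ?_)
    · refine lintegral_congr fun w => ?_
      by_cases hw : ofCoords w ∈ {M : HermMat N | M.MinGapLE δ}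
      · rw [Set.indicator_of_mem hw, Set.indicator_of_mem (by exact hw), mul_one]
      · rw [Set.indicator_of_notMem hw, Set.indicator_of_notMem (by exact hw), mul_zero]
    · rw [mul_right_comm]
      exact hvol n δ hn hδ0 hδ1
  have hpsi : 0 ≤ P.psi := (Real.exp_pos _).le
  rw [hzZ]
  calc _ ≤ ENNReal.ofReal P.psi * (ENNReal.ofReal z *
        (ENNReal.ofReal ((Real.exp (-(N : ℝ)) ^ (N * N))⁻¹) * ENNReal.ofReal (K * (C * δ ^ 2)))) := by
        gcongr
    _ = _ := by
      rw [← ENNReal.ofReal_mul (by positivity), ← ENNReal.ofReal_mul hz0,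
        ← ENNReal.ofReal_mul hpsi]
      congr 1
      ring

/-- A dyadic layer decomposition: if `x` lies between `2^{-(k+2)}` and `2^{-(k+1)}`, the `k`-th
summand alone suffices; the constant `2` covers `x > 1/2`, and at `x = 0` the series diverges. It
turns gap probabilities into a bound on the inverse gap. -/
theorem inv_ofReal_le_two_add_tsum {x : ℝ} (hx : 0 ≤ x) :
    (ENNReal.ofReal x)⁻¹ ≤
      2 + ∑' k : ℕ, if x ≤ (1 / 2) ^ (k + 1) then (2 : ℝ≥0∞) ^ (k + 2) else 0 := by
  have hinv : ∀ n : ℕ, (1 / 2 : ℝ) ^ n < x → (ENNReal.ofReal x)⁻¹ ≤ 2 ^ n := fun n hn => by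
    rw [ENNReal.inv_le_iff_inv_le, ← ENNReal.ofReal_ofNat, ← ENNReal.ofReal_pow (by norm_num),
      ← ENNReal.ofReal_inv_of_pos (by positivity)]
    apply ENNReal.ofReal_le_ofReal
    rw [← inv_pow, ← one_div]
    exact hn.le
  rcases hx.eq_or_lt with rfl | hx0
  · have : ∑' k : ℕ, (if (0 : ℝ) ≤ (1 / 2) ^ (k + 1) then (2 : ℝ≥0∞) ^ (k + 2) else 0) = ∞ := by
      rw [eq_top_iff, ← ENNReal.tsum_const_eq_top_of_ne_zero (α := ℕ) (one_ne_zero (α := ℝ≥0∞))]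
      refine ENNReal.tsum_le_tsum fun k => ?_
      rw [if_pos (by positivity)]
      exact one_le_pow₀ one_le_two
    rw [this]
    simp
  rcases le_or_gt x 1 with hx1 | hx1
  · obtain ⟨n, hn1, hn2⟩ := exists_nat_pow_near_of_lt_one hx0 hx1 (by norm_num : (0 : ℝ) < 1 / 2)
      (by norm_num)
    rcases n with _ | k
    · refine (hinv 1 (by simpa using hn1)).trans ?_
      simp
    · refine (hinv _ hn1).trans (le_trans ?_ le_add_self)
      refine le_trans ?_ (ENNReal.le_tsum k)
      rw [if_pos hn2]
  · refine (hinv 1 (by linarith)).trans ?_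
    simp

/-- The expectation of the sum of the inverse gaps. -/
theorem exists_lintegral_invGapSum_le (hN : 1 ≤ N) : ∃ c : ℝ, 0 ≤ c ∧ ∀ P : HermMat N,
    ∫⁻ q, (P.perturb q).invGapSum ∂(gue N) ≤ ENNReal.ofReal (c * P.psi) := by
  obtain ⟨c, hc, hgap⟩ := exists_gue_minGapLE_le hN
  have := isProbabilityMeasure_gue hN
  refine ⟨((Finset.univ : Finset (Fin N)).offDiag.card : ℝ) * (2 + 2 * c), by positivity,
    fun P => ?_⟩
  have hpert : Measurable fun q => P.perturb q := measurable_perturb.comp measurable_prodMk_left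
  have hpsi : 1 ≤ P.psi := Real.one_le_exp (mul_nonneg (Real.exp_pos _).le P.frobSq_nonneg)
  have hpair : ∀ p ∈ (Finset.univ : Finset (Fin N)).offDiag,
      ∫⁻ q, (ENNReal.ofReal |(P.perturb q).eig p.1 - (P.perturb q).eig p.2|)⁻¹ ∂(gue N) ≤
        ENNReal.ofReal ((2 + 2 * c) * P.psi) := by
    intro p hp
    have hne : p.1 ≠ p.2 := (Finset.mem_offDiag.1 hp).2.2
    have h1 : ∀ q, (ENNReal.ofReal |(P.perturb q).eig p.1 - (P.perturb q).eig p.2|)⁻¹ ≤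
        2 + ∑' k : ℕ, {q | (P.perturb q).MinGapLE ((1 / 2) ^ (k + 1))}.indicator
          (fun _ => (2 : ℝ≥0∞) ^ (k + 2)) q := by
      intro q
      refine (inv_ofReal_le_two_add_tsum (abs_nonneg _)).trans ?_
      gcongr with k
      split_ifs with h
      · rw [Set.indicator_of_mem]
        exact ⟨p.1, p.2, hne, h⟩
      · exact zero_le
    have hm : ∀ k : ℕ, MeasurableSet {q | (P.perturb q).MinGapLE ((1 / 2) ^ (k + 1))} := fun k =>
      hpert (measurableSet_minGapLE _)
    refine (lintegral_mono h1).trans ?_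
    rw [lintegral_add_left measurable_const, lintegral_const, measure_univ, mul_one,
      lintegral_tsum fun k => (measurable_const.indicator (hm k)).aemeasurable]
    -- The weight `2 ^ (k + 2)` meets a probability of order `4 ^ (-(k + 1))`; the quadratic
    -- exponent in the gap bound leaves a geometric series.
    have hterm : ∀ k : ℕ, ∫⁻ q, {q | (P.perturb q).MinGapLE ((1 / 2) ^ (k + 1))}.indicator
          (fun _ => (2 : ℝ≥0∞) ^ (k + 2)) q ∂(gue N) ≤
          ENNReal.ofReal (c * P.psi * (1 / 2) ^ k) := by
      intro k
      rw [lintegral_indicator (hm k), setLIntegral_const]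
      refine (mul_le_mul_right (hgap P ((1 / 2) ^ (k + 1)) (by positivity)
        (pow_lt_one₀ (by norm_num) (by norm_num) (by simp))) _).trans ?_
      rw [← ENNReal.ofReal_ofNat, ← ENNReal.ofReal_pow (by norm_num),
        ← ENNReal.ofReal_mul (by positivity)]
      apply ENNReal.ofReal_le_ofReal
      apply le_of_eq
      have h4 : (2 : ℝ) ^ k * (1 / 2) ^ k = 1 := by rw [← mul_pow]; norm_num
      calc (2 : ℝ) ^ (k + 2) * (c * P.psi * ((1 / 2) ^ (k + 1)) ^ 2) =
          (2 ^ k * (1 / 2) ^ k) * (c * P.psi * (1 / 2) ^ k) := by ring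
        _ = _ := by rw [h4, one_mul]
    have hs : HasSum (fun k : ℕ => c * P.psi * (1 / 2 : ℝ) ^ k) (c * P.psi * 2) :=
      hasSum_geometric_two.mul_left _
    have hpsi0 : 0 ≤ P.psi := by linarith
    calc _ ≤ 2 + ∑' k : ℕ, ENNReal.ofReal (c * P.psi * (1 / 2) ^ k) := by
          gcongr with k; exact hterm k
      _ = ENNReal.ofReal (2 + c * P.psi * 2) := by
          rw [← ENNReal.ofReal_tsum_of_nonneg (fun k => by positivity) hs.summable, hs.tsum_eq,
            ENNReal.ofReal_add (by norm_num) (by positivity), ENNReal.ofReal_ofNat]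
      _ ≤ _ := by
          apply ENNReal.ofReal_le_ofReal
          -- Here `1 ≤ P.psi` absorbs the additive `2`.
          nlinarith
  simp only [invGapSum]
  rw [lintegral_finsetSum]
  · refine (Finset.sum_le_sum hpair).trans ?_
    rw [Finset.sum_const, ← ENNReal.ofReal_nsmul]
    apply ENNReal.ofReal_le_ofReal
    rw [nsmul_eq_mul, mul_assoc]
  · intro p _
    exact (((measurable_eig p.1).comp hpert).sub
      ((measurable_eig p.2).comp hpert)).abs.ennreal_ofReal.inv

theorem injective_eig_of_invGapSum_lt_top {M : HermMat N} (h : M.invGapSum < ∞) :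
    Function.Injective M.eig := by
  intro i j hij
  by_contra hne
  rw [invGapSum, ENNReal.sum_lt_top] at h
  have := h (i, j) (by simpa using hne)
  simp [hij] at this

end HermMat
end

/-! ### Conditioning on an independent variable. -/

noncomputable section

/-- For independent random variables `X` and `Y`, the conditional expectation of `F (X, Y)` given
`X` is obtained by integrating out `Y`. -/
theorem condLExp_comap_ae_eq_of_indepFun {Ω α β : Type*} [MeasurableSpace Ω] [MeasurableSpace α]
    [MeasurableSpace β] {μ : Measure Ω} [IsProbabilityMeasure μ] {X : Ω → α} {Y : Ω → β}
    (hX : Measurable X) (hY : Measurable Y) (hXY : IndepFun X Y μ) {F : α × β → ℝ≥0∞}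
    (hF : Measurable F) :
    (fun ω => ∫⁻ y, F (X ω, y) ∂(μ.map Y)) =ᵐ[μ]
      condLExp (MeasurableSpace.comap X inferInstance) μ (fun ω => F (X ω, Y ω)) := by
  have hm : MeasurableSpace.comap X inferInstance ≤ (inferInstance : MeasurableSpace Ω) :=
    hX.comap_le
  have hYp : IsProbabilityMeasure (μ.map Y) := Measure.isProbabilityMeasure_map hY.aemeasurable
  have hint : Measurable fun x => ∫⁻ y, F (x, y) ∂(μ.map Y) := hF.lintegral_prod_right'
  refine ae_eq_condLExp hm μ _ (hint.comp (comap_measurable X)) fun s hs => ?_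
  obtain ⟨t, ht, rfl⟩ := hs
  have hprod := (indepFun_iff_map_prod_eq_prod_map_map hX.aemeasurable hY.aemeasurable).1 hXY
  have hFt : Measurable ((t ×ˢ Set.univ).indicator F) :=
    hF.indicator (ht.prod MeasurableSet.univ)
  calc ∫⁻ ω in X ⁻¹' t, ∫⁻ y, F (X ω, y) ∂(μ.map Y) ∂μ
      = ∫⁻ x in t, ∫⁻ y, F (x, y) ∂(μ.map Y) ∂(μ.map X) := (setLIntegral_map ht hint hX).symm
    _ = ∫⁻ x, ∫⁻ y, (t ×ˢ Set.univ).indicator F (x, y) ∂(μ.map Y) ∂(μ.map X) := by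
        rw [← lintegral_indicator ht]
        refine lintegral_congr fun x => ?_
        by_cases hx : x ∈ t <;> simp [hx, Set.indicator]
    _ = ∫⁻ z, (t ×ˢ Set.univ).indicator F z ∂((μ.map X).prod (μ.map Y)) :=
        (lintegral_prod _ hFt.aemeasurable).symm
    _ = ∫⁻ ω, (t ×ˢ Set.univ).indicator F (X ω, Y ω) ∂μ := by
        rw [← hprod, lintegral_map hFt (hX.prodMk hY)]
    _ = ∫⁻ ω in X ⁻¹' t, F (X ω, Y ω) ∂μ := by
        rw [← lintegral_indicator (hX ht)]
        refine lintegral_congr fun ω => ?_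
        by_cases hx : X ω ∈ t <;> simp [hx, Set.indicator]

/-! ### Eigenvalue displacement and the tail of the GUE norm. -/

namespace HermMat

variable {N : ℕ}

/-- Weyl's inequality gives `e^{-N/2} ≤ e^{-N} ‖Q‖`. The resulting event does not involve `P`, so
the same tail bound serves deterministic and random `P`. -/
theorem exp_le_frobSq_of_farEigenvalues {P Q : HermMat N}
    (h : (P.perturb Q).FarEigenvalues P) : Real.exp N ≤ Q.frobSq := by
  obtain ⟨k, hk⟩ := h
  have h1 := hk.trans (abs_eig_sub_eig_le _ _ k)
  have h2 : P.perturb Q - P = Real.exp (-(N : ℝ)) • Q := by rw [perturb]; abel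
  rw [h2, frobSq_smul, Real.sqrt_mul (by positivity), Real.sqrt_sq (Real.exp_pos _).le] at h1
  have h3 : Real.exp ((N : ℝ) / 2) ≤ √Q.frobSq := by
    have h4 : Real.exp ((N : ℝ) / 2) = Real.exp N * Real.exp (-((N : ℝ) / 2)) := by
      rw [← Real.exp_add]; congr 1; ring
    have h5 : Real.exp (N : ℝ) * Real.exp (-(N : ℝ)) = 1 := by rw [← Real.exp_add]; simp
    rw [h4]
    calc _ ≤ Real.exp N * (Real.exp (-(N : ℝ)) * √Q.frobSq) := by gcongr
      _ = _ := by rw [← mul_assoc, h5, one_mul]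
  calc Real.exp N = Real.exp ((N : ℝ) / 2) ^ 2 := by
        rw [← Real.exp_nat_mul]; congr 1; push_cast; ring
    _ ≤ √Q.frobSq ^ 2 := by gcongr
    _ = _ := Real.sq_sqrt Q.frobSq_nonneg

/-- The rate `3N/8` leaves `N/8`, a quarter of the GUE exponent `N/2`, so the integrand is the
weight evaluated at `w / 2`; rescaling `N * N` real coordinates gives the exact value. -/
theorem lintegral_exp_frobSq_gue (hN : 1 ≤ N) :
    ∫⁻ q, ENNReal.ofReal (Real.exp (3 * N / 8 * q.frobSq)) ∂(gue N) = 2 ^ (N * N) := by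
  have hm : Measurable fun q : HermMat N => ENNReal.ofReal (Real.exp (3 * N / 8 * q.frobSq)) :=
    (Real.measurable_exp.comp (measurable_frobSq.const_mul _)).ennreal_ofReal
  have hg : Measurable fun w : Fin N → Fin N → ℝ => gueWeight (ofCoords w) :=
    measurable_gueWeight.comp measurable_ofCoords
  have h := lintegral_comp_add_smul hg 0 (s := 1 / 2) (by norm_num)
  have h1 : ∫⁻ w : Fin N → Fin N → ℝ, gueWeight (ofCoords w) *
      ENNReal.ofReal (Real.exp (3 * N / 8 * (ofCoords w).frobSq)) = 2 ^ (N * N) * partition N := by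
    have h2 : ENNReal.ofReal (((1 / 2 : ℝ) ^ (N * N))⁻¹) = 2 ^ (N * N) := by
      rw [← inv_pow, one_div, inv_inv, ENNReal.ofReal_pow (by norm_num), ENNReal.ofReal_ofNat]
    rw [h2] at h
    rw [partition, ← h]
    refine lintegral_congr fun w => ?_
    rw [zero_add, ofCoords_smul, gueWeight, gueWeight, frobSq_smul,
      ← ENNReal.ofReal_mul (by positivity), ← Real.exp_add]
    congr 2
    ring
  rw [lintegral_gue hm, h1, mul_left_comm,
    ENNReal.inv_mul_cancel partition_ne_zero (partition_ne_top hN), mul_one]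

/-- The numerical inequality behind the Chernoff bound. It is tight at `N = 2`, hence the decimal
bounds on `e` and `log 2`, and it fails at `N = 1`, which is why that case has its own proof. -/
theorem tail_exponent_le {x : ℝ} (hN : 2 ≤ N) (hx : x = Real.exp ((N : ℝ) / 2)) :
    (N * N : ℝ) * Real.log 2 + x ≤ 3 * N / 8 * x ^ 2 := by
  have hlog := Real.log_two_lt_d9
  rcases hN.eq_or_lt with rfl | h3
  · have hx' : x = Real.exp 1 := by rw [hx]; norm_num
    have := Real.exp_one_gt_d9
    rw [← hx'] at this
    push_cast
    nlinarith
  · have hN3 : (3 : ℝ) ≤ N := by exact_mod_cast h3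
    have hy : 1 + (N : ℝ) / 2 + (N : ℝ) ^ 2 / 8 ≤ x := by
      rw [hx]
      have := Real.quadratic_le_exp_of_nonneg (x := (N : ℝ) / 2) (by positivity)
      linarith
    -- Chosen so that `3 / 8 * 3.6 = 1.35`, the coefficient used next.
    have hx36 : 3.6 ≤ x := by nlinarith
    have h1 : (N * N : ℝ) * Real.log 2 ≤ 0.7 * N ^ 2 := by nlinarith
    have h2 : 1.35 * N - 1 ≤ 3 * N / 8 * x - 1 := by nlinarith
    have h3 : (1 + (N : ℝ) / 2 + (N : ℝ) ^ 2 / 8) * (1.35 * N - 1) ≤ x * (3 * N / 8 * x - 1) :=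
      mul_le_mul hy h2 (by nlinarith) (by linarith)
    have h4 : 0.7 * (N : ℝ) ^ 2 ≤ (1 + (N : ℝ) / 2 + (N : ℝ) ^ 2 / 8) * (1.35 * N - 1) := by
      nlinarith [mul_nonneg (sq_nonneg (N : ℝ)) (sub_nonneg.2 hN3)]
    nlinarith

theorem gue_frobSq_ge_le_of_two_le (hN : 2 ≤ N) :
    gue N {q | Real.exp N ≤ q.frobSq} ≤
      ENNReal.ofReal (Real.exp (-Real.exp ((N : ℝ) / 2))) := by
  set a : ℝ := Real.exp (3 * N / 8 * Real.exp N) with ha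
  have hm : Measurable fun q : HermMat N => ENNReal.ofReal (Real.exp (3 * N / 8 * q.frobSq)) :=
    (Real.measurable_exp.comp (measurable_frobSq.const_mul _)).ennreal_ofReal
  have h := mul_meas_ge_le_lintegral hm (ENNReal.ofReal a) (μ := gue N)
  rw [lintegral_exp_frobSq_gue (by omega)] at h
  have hsub : {q : HermMat N | Real.exp N ≤ q.frobSq} ⊆
      {q | ENNReal.ofReal a ≤ ENNReal.ofReal (Real.exp (3 * N / 8 * q.frobSq))} := by
    intro q hq
    have hq' : Real.exp N ≤ q.frobSq := hq
    refine ENNReal.ofReal_le_ofReal ?_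
    rw [ha, Real.exp_le_exp]
    gcongr
  have ha0 : ENNReal.ofReal a ≠ 0 := by rw [Ne, ENNReal.ofReal_eq_zero, not_le]; positivity
  rw [← ENNReal.mul_le_mul_iff_right ha0 ENNReal.ofReal_ne_top]
  refine (mul_le_mul_right (measure_mono hsub) _).trans (h.trans ?_)
  rw [← ENNReal.ofReal_mul (by positivity), ← ENNReal.ofReal_ofNat,
    ← ENNReal.ofReal_pow (by norm_num)]
  apply ENNReal.ofReal_le_ofReal
  have h2 : (2 : ℝ) ^ (N * N) = Real.exp ((N * N : ℝ) * Real.log 2) := by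
    rw [mul_comm, ← Nat.cast_mul, mul_comm, Real.exp_nat_mul, Real.exp_log two_pos]
  rw [h2, ha, ← Real.exp_add, Real.exp_le_exp]
  have h3 := tail_exponent_le hN rfl
  rw [← Real.exp_nat_mul] at h3
  have h4 : ((2 : ℕ) : ℝ) * ((N : ℝ) / 2) = N := by push_cast; ring
  rw [h4] at h3
  linarith

theorem lintegral_fin_one {f : (Fin 1 → Fin 1 → ℝ) → ℝ≥0∞} :
    ∫⁻ w, f w = ∫⁻ x : ℝ, f (fun _ _ => x) := by
  let e₁ := MeasurableEquiv.funUnique (Fin 1) (Fin 1 → ℝ)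
  let e₂ := MeasurableEquiv.funUnique (Fin 1) ℝ
  have h1 : MeasurePreserving e₁ := volume_preserving_funUnique (Fin 1) (Fin 1 → ℝ)
  have h2 : MeasurePreserving e₂ := volume_preserving_funUnique (Fin 1) ℝ
  rw [← (h1.symm e₁).lintegral_comp_emb e₁.symm.measurableEmbedding f,
    ← (h2.symm e₂).lintegral_comp_emb e₂.symm.measurableEmbedding]
  rfl

theorem frobSq_fin_one (x : ℝ) : (ofCoords (fun _ _ : Fin 1 => x)).frobSq = x ^ 2 := by
  simp [frobSq, ofCoords, matrixOfCoords]

theorem two_le_partition_one : 2 ≤ partition 1 := by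
  have h : partition 1 = ENNReal.ofReal √(Real.pi / (1 / 2)) := by
    rw [partition, lintegral_fin_one, ← integral_gaussian,
      ofReal_integral_eq_lintegral_ofReal (integrable_exp_neg_mul_sq (by norm_num))
        (Filter.Eventually.of_forall fun x => (Real.exp_pos _).le)]
    refine lintegral_congr fun x => ?_
    rw [gueWeight, frobSq_fin_one]
    norm_num
  rw [h, ← ENNReal.ofReal_ofNat]
  apply ENNReal.ofReal_le_ofReal
  apply Real.le_sqrt_of_sq_le
  have := Real.pi_gt_three
  linarith

/-- The tangent line to `x ^ 2` at `a` bounds the Gaussian by `exp (a ^ 2 / 2 - a * x)`, which is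
integrated exactly over each half-line. -/
theorem setLIntegral_gaussian_abs_ge_le {a : ℝ} (ha : 0 < a) :
    ∫⁻ x : ℝ, {x | a ≤ |x|}.indicator (fun x => ENNReal.ofReal (Real.exp (-(1 / 2) * x ^ 2))) x ≤
      2 * ENNReal.ofReal (Real.exp (-(a ^ 2 / 2)) / a) := by
  have hpt : ∀ x : ℝ, {x | a ≤ |x|}.indicator
      (fun x => ENNReal.ofReal (Real.exp (-(1 / 2) * x ^ 2))) x ≤
      (Set.Ici a).indicator (fun x => ENNReal.ofReal (Real.exp (a ^ 2 / 2) * Real.exp (-a * x))) x +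
      (Set.Ici a).indicator
        (fun x => ENNReal.ofReal (Real.exp (a ^ 2 / 2) * Real.exp (-a * x))) (-x) := by
    intro x
    by_cases hx : a ≤ |x|
    · have hle : ∀ y : ℝ, ENNReal.ofReal (Real.exp (-(1 / 2) * y ^ 2)) ≤
          ENNReal.ofReal (Real.exp (a ^ 2 / 2) * Real.exp (-a * y)) := fun y => by
        apply ENNReal.ofReal_le_ofReal
        rw [← Real.exp_add, Real.exp_le_exp]
        nlinarith [sq_nonneg (y - a)]
      rw [Set.indicator_of_mem (by exact hx)]
      rcases le_abs'.1 hx with h | h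
      · refine le_trans ?_ le_add_self
        rw [Set.indicator_of_mem (by rw [Set.mem_Ici]; linarith)]
        simpa using hle (-x)
      · refine le_trans ?_ le_self_add
        rw [Set.indicator_of_mem (by exact h)]
        exact hle x
    · rw [Set.indicator_of_notMem (by exact hx)]
      exact zero_le
  have hmeas : Measurable ((Set.Ici a).indicator
      (fun x => ENNReal.ofReal (Real.exp (a ^ 2 / 2) * Real.exp (-a * x)))) := by
    refine Measurable.indicator ?_ measurableSet_Ici
    fun_prop
  have hint : ∫⁻ x, (Set.Ici a).indicator
      (fun x => ENNReal.ofReal (Real.exp (a ^ 2 / 2) * Real.exp (-a * x))) x =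
      ENNReal.ofReal (Real.exp (-(a ^ 2 / 2)) / a) := by
    rw [lintegral_indicator measurableSet_Ici, setLIntegral_congr Ioi_ae_eq_Ici.symm,
      ← ofReal_integral_eq_lintegral_ofReal
        ((integrableOn_exp_mul_Ioi (by linarith) a).const_mul _)
        (Filter.Eventually.of_forall fun x => by positivity),
      integral_const_mul, integral_exp_mul_Ioi (by linarith)]
    congr 1
    have : Real.exp (-(a ^ 2 / 2)) = Real.exp (a ^ 2 / 2) * Real.exp (-a * a) := by
      rw [← Real.exp_add]; congr 1; ring
    rw [this]
    field_simp
  refine (lintegral_mono hpt).trans (le_of_eq ?_)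
  rw [lintegral_add_left hmeas, lintegral_neg_eq_self, hint, two_mul]

theorem gue_one_frobSq_ge_le :
    gue 1 {q | Real.exp (1 : ℕ) ≤ q.frobSq} ≤
      ENNReal.ofReal (Real.exp (-Real.exp (((1 : ℕ) : ℝ) / 2))) := by
  set a : ℝ := Real.exp (1 / 2) with ha
  have ha0 : 0 < a := Real.exp_pos _
  have ha2 : a ^ 2 = Real.exp 1 := by rw [ha, ← Real.exp_nat_mul]; norm_num
  have hS : MeasurableSet {q : HermMat 1 | Real.exp (1 : ℕ) ≤ q.frobSq} :=
    measurableSet_le measurable_const measurable_frobSq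
  rw [← lintegral_indicator_one hS, lintegral_gue (measurable_one.indicator hS), lintegral_fin_one]
  have h1 : ∫⁻ x : ℝ, gueWeight (ofCoords (fun _ _ : Fin 1 => x)) *
      {q : HermMat 1 | Real.exp (1 : ℕ) ≤ q.frobSq}.indicator 1 (ofCoords fun _ _ => x) ≤
      2 * ENNReal.ofReal (Real.exp (-(a ^ 2 / 2)) / a) := by
    refine le_trans (le_of_eq (lintegral_congr fun x => ?_)) (setLIntegral_gaussian_abs_ge_le ha0)
    have hiff : ofCoords (fun _ _ : Fin 1 => x) ∈ {q : HermMat 1 | Real.exp (1 : ℕ) ≤ q.frobSq} ↔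
        x ∈ {x : ℝ | a ≤ |x|} := by
      rw [Set.mem_ofPred_eq, Set.mem_ofPred_eq, frobSq_fin_one, Nat.cast_one, ← ha2, sq_le_sq,
        abs_of_pos ha0]
    by_cases hx : x ∈ {x : ℝ | a ≤ |x|}
    · rw [Set.indicator_of_mem hx, Set.indicator_of_mem (hiff.2 hx), gueWeight, frobSq_fin_one]
      simp
    · rw [Set.indicator_of_notMem hx, Set.indicator_of_notMem (fun h => hx (hiff.1 h)), mul_zero]
  have h2 : (partition 1)⁻¹ * 2 ≤ 1 := by
    calc (partition 1)⁻¹ * 2 ≤ (partition 1)⁻¹ * partition 1 := by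
          gcongr; exact two_le_partition_one
      _ = 1 := ENNReal.inv_mul_cancel partition_ne_zero (partition_ne_top le_rfl)
  calc _ ≤ (partition 1)⁻¹ * (2 * ENNReal.ofReal (Real.exp (-(a ^ 2 / 2)) / a)) := by gcongr
    _ = (partition 1)⁻¹ * 2 * ENNReal.ofReal (Real.exp (-(a ^ 2 / 2)) / a) := by rw [mul_assoc]
    _ ≤ 1 * ENNReal.ofReal (Real.exp (-(a ^ 2 / 2)) / a) := by gcongr
    _ ≤ _ := by
      rw [one_mul]
      apply ENNReal.ofReal_le_ofReal
      rw [Nat.cast_one, ← ha]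
      have h3 : Real.exp (-(a ^ 2 / 2)) / a = Real.exp (-(a ^ 2 / 2) - 1 / 2) := by
        rw [Real.exp_sub, ← ha]
      rw [h3, Real.exp_le_exp]
      -- With `a = e^{1/2}`, dividing by `a` contributes `-1/2` to the exponent, and `a ≤ a ^ 2 / 2
      -- + 1 / 2`.
      nlinarith [sq_nonneg (a - 1)]

/-- The tail of the Frobenius norm of a GUE matrix. -/
theorem gue_frobSq_ge_le (hN : 1 ≤ N) :
    gue N {q | Real.exp N ≤ q.frobSq} ≤
      ENNReal.ofReal (Real.exp (-Real.exp ((N : ℝ) / 2))) := by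
  rcases hN.eq_or_lt with rfl | h
  · exact gue_one_frobSq_ge_le
  · exact gue_frobSq_ge_le_of_two_le h

end HermMat
end

/-! ### Assembly of the deterministic and conditional statements. -/

theorem proposition2p2 (N : ℕ) (hN : 1 ≤ N) :
    ∃ c : ℝ, 0 < c ∧
      ∀ (Ω : Type*) [MeasurableSpace Ω] (μ : Measure Ω) [IsProbabilityMeasure μ]
        (Q : Ω → HermMat N), Measurable Q → μ.map Q = HermMat.gue N →
        (∀ P : HermMat N,
          (∀ᵐ ω ∂μ, Function.Injective (P.perturb (Q ω)).eig) ∧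
          (∫⁻ ω, (P.perturb (Q ω)).invGapSum ∂μ < ENNReal.ofReal (c * P.psi)) ∧
          (∀ δ : ℝ, 0 < δ → δ < 1 →
            μ {ω | (P.perturb (Q ω)).MinGapLE δ} ≤ ENNReal.ofReal (c * P.psi * δ ^ 2)) ∧
          (μ {ω | (P.perturb (Q ω)).FarEigenvalues P} ≤
            ENNReal.ofReal (Real.exp (-Real.exp ((N : ℝ) / 2))))) ∧
        (∀ P : Ω → HermMat N, Measurable P → IndepFun P Q μ →
          (∀ᵐ ω ∂μ, Function.Injective ((P ω).perturb (Q ω)).eig) ∧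
          (∀ᵐ ω ∂μ,
            condLExp (MeasurableSpace.comap P inferInstance) μ
                (fun ω' => ((P ω').perturb (Q ω')).invGapSum) ω
              < ENNReal.ofReal (c * (P ω).psi)) ∧
          (∀ δ : ℝ, 0 < δ → δ < 1 → ∀ᵐ ω ∂μ,
            condLExp (MeasurableSpace.comap P inferInstance) μ
                ({ω' | ((P ω').perturb (Q ω')).MinGapLE δ}.indicator fun _ => 1) ω
              ≤ ENNReal.ofReal (c * (P ω).psi * δ ^ 2)) ∧
          (μ {ω | ((P ω).perturb (Q ω)).FarEigenvalues (P ω)} ≤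
            ENNReal.ofReal (Real.exp (-Real.exp ((N : ℝ) / 2))))) := by
  obtain ⟨c₁, hc₁, hgap⟩ := HermMat.exists_gue_minGapLE_le hN
  obtain ⟨c₂, hc₂, hinv⟩ := HermMat.exists_lintegral_invGapSum_le hN
  have hpsi : ∀ P : HermMat N, 0 < P.psi := fun P => Real.exp_pos _
  have hinv' : ∀ P : HermMat N, ∫⁻ q, (P.perturb q).invGapSum ∂(HermMat.gue N) <
      ENNReal.ofReal ((c₁ + c₂ + 1) * P.psi) := fun P => by
    refine (hinv P).trans_lt ?_
    have := hpsi P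
    rw [ENNReal.ofReal_lt_ofReal_iff (by positivity)]
    nlinarith
  have hgap' : ∀ (P : HermMat N) (δ : ℝ), 0 < δ → δ < 1 →
      HermMat.gue N {q | (P.perturb q).MinGapLE δ} ≤
        ENNReal.ofReal ((c₁ + c₂ + 1) * P.psi * δ ^ 2) := fun P δ h0 h1 => by
    refine (hgap P δ h0 h1).trans (ENNReal.ofReal_le_ofReal ?_)
    have := hpsi P
    gcongr
    linarith
  have hpert : ∀ P : HermMat N, Measurable fun q => P.perturb q := fun P =>
    HermMat.measurable_perturb.comp measurable_prodMk_left
  have hinvm : ∀ P : HermMat N, Measurable fun q => (P.perturb q).invGapSum := fun P =>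
    HermMat.measurable_invGapSum.comp (hpert P)
  have hgapm : ∀ (P : HermMat N) (δ : ℝ), MeasurableSet {q | (P.perturb q).MinGapLE δ} :=
    fun P δ => hpert P (HermMat.measurableSet_minGapLE δ)
  -- The extra `1` makes the constant positive and the expectation bound strict, even when the sum
  -- over pairs is empty.
  refine ⟨c₁ + c₂ + 1, by positivity, fun Ω _ μ _ Q hQ hlaw => ⟨fun P => ?_, fun P hP hPQ => ?_⟩⟩
  · have hE : ∫⁻ ω, (P.perturb (Q ω)).invGapSum ∂μ =
        ∫⁻ q, (P.perturb q).invGapSum ∂(HermMat.gue N) := by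
      rw [← hlaw, lintegral_map (hinvm P) hQ]
    refine ⟨?_, hE ▸ hinv' P, fun δ h0 h1 => ?_, ?_⟩
    · have hfin : ∫⁻ ω, (P.perturb (Q ω)).invGapSum ∂μ ≠ ∞ :=
        ((hE ▸ hinv' P).trans ENNReal.ofReal_lt_top).ne
      filter_upwards [ae_lt_top ((hinvm P).comp hQ) hfin]
        with ω hω using HermMat.injective_eig_of_invGapSum_lt_top hω
    · refine le_of_eq_of_le ?_ (hgap' P δ h0 h1)
      rw [← hlaw, Measure.map_apply hQ (hgapm P δ)]
      rfl
    · refine le_trans ?_ (HermMat.gue_frobSq_ge_le hN)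
      rw [← hlaw, Measure.map_apply hQ
        (measurableSet_le measurable_const HermMat.measurable_frobSq)]
      exact measure_mono fun ω hω => HermMat.exp_le_frobSq_of_farEigenvalues hω
  · have hF : Measurable fun x : HermMat N × HermMat N => (x.1.perturb x.2).invGapSum :=
      HermMat.measurable_invGapSum.comp HermMat.measurable_perturb
    have hcond := condLExp_comap_ae_eq_of_indepFun hP hQ hPQ hF
    rw [hlaw] at hcond
    have hPp : IsProbabilityMeasure (μ.map P) := Measure.isProbabilityMeasure_map hP.aemeasurable
    have hgue := HermMat.isProbabilityMeasure_gue hN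
    refine ⟨?_, ?_, fun δ h0 h1 => ?_, ?_⟩
    · have hprod := (indepFun_iff_map_prod_eq_prod_map_map hP.aemeasurable hQ.aemeasurable).1 hPQ
      rw [hlaw] at hprod
      -- Finiteness is proved on the product law, section by section, because the expectation of
      -- `psi` over random `P` may be infinite.
      have hae : ∀ᵐ x ∂((μ.map P).prod (HermMat.gue N)), (x.1.perturb x.2).invGapSum < ∞ := by
        rw [Measure.ae_prod_iff_ae_ae (measurableSet_lt hF measurable_const)]
        refine Filter.Eventually.of_forall fun x => ?_
        exact ae_lt_top (hinvm x)
          ((hinv' x).trans ENNReal.ofReal_lt_top).ne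
      rw [← hprod] at hae
      filter_upwards [ae_of_ae_map (hP.prodMk hQ).aemeasurable hae] with ω hω using
        HermMat.injective_eig_of_invGapSum_lt_top hω
    · filter_upwards [hcond] with ω hω
      rw [← hω]
      exact hinv' (P ω)
    · have hS := HermMat.measurable_perturb (N := N) (HermMat.measurableSet_minGapLE δ)
      have hc := condLExp_comap_ae_eq_of_indepFun hP hQ hPQ
        ((measurable_const (a := (1 : ENNReal))).indicator hS)
      rw [hlaw] at hc
      filter_upwards [hc] with ω hω
      refine le_of_eq_of_le hω.symm (le_of_eq_of_le ?_ (hgap' (P ω) δ h0 h1))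
      rw [← lintegral_indicator_one (hgapm (P ω) δ)]
      rfl
    · refine le_trans ?_ (HermMat.gue_frobSq_ge_le hN)
      rw [← hlaw, Measure.map_apply hQ
        (measurableSet_le measurable_const HermMat.measurable_frobSq)]
      exact measure_mono fun ω hω => HermMat.exp_le_frobSq_of_farEigenvalues hω
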